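/- **Notation.** Let $k,m,N$ be positive integers with $m$ square-free and let $\chi$ be a Dirichlet character modulo $mN$, regarded as the character $\begin{pmatrix}a&b\\c&d\end{pmatrix}\mapsto\chi(d)$ of $\Gamma_0(mN)$. Write $e(x)=e^{2\pi i x}$. For $r\ge 0$ put $$\theta^J_{m,r}(\tau,z)=\sum_{n\in\mathbb Z}e\Big(m\big((n+\tfrac r{2m})^2\tau+2(n+\tfrac r{2m})z\big)\Big)\qquad(\tau\in\mathbb H,\ z\in\mathbb C).$$ For $\gamma=\begin{pmatrix}a&b\\c&d\end{pmatrix}\in SL_2(\mathbb Z)$ let $U_1(\gamma)$ be the unique complex $2\times2$ matrix with $$\begin{pmatrix}\theta^J_{1,0}\\ \theta^J_{1,1}\end{pmatrix}\Big(\frac{a\tau+b}{c\tau+d},\frac z{c\tau+d}\Big)=e\Big(\frac{cz^2}{c\tau+d}\Big)(c\tau+d)^{1/2}\,U_1(\gamma)\begin{pmatrix}\theta^J_{1,0}\\ \theta^J_{1,1}\end{pmatrix}(\tau,z)$$ (principal square root). For $\gamma=\begin{pmatrix}a&b\\c&d\end{pmatrix}\in\Gamma_0(m)$ let $\omega_m(\gamma)=\det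 U_1\begin{pmatrix}a&mb\\c/m&d\end{pmatrix}$; this is a character of $\Gamma_0(m)$. Put $\omega=\omega_1$. On $\Gamma_0(mN)$, $\omega_m$ and $\omega$ denote the restrictions. For a character $\nu$ of $\Gamma_0(M)$ and a positive integer $m$: * $M_{k}(\Gamma_0(M),\nu)$ is the space of holomorphic $f:\mathbb H\to\mathbb C$ with $f(\gamma\tau)=\nu(\gamma)(c\tau+d)^{k}f(\tau)$ for all $\gamma\in\Gamma_0(M)$ that are holomorphic at all cusps, i.e. $(c\tau+d)^{-k}f(g\tau)$ is bounded as $\operatorname{Im}\tau\to\infty$ for every $g=\begin{pmatrix}a&b\\c&d\end{pmatrix}\in SL_2(\mathbb Z)$. * $J_{k,m}(\Gamma_0(M),\nu)$ is the space of Jacobi forms of weight $k$, index $m$ and character $\nu$: holomorphic $\phi:\mathbb H\times\mathbb C\to\mathbb C$ such that $\phi|_{k,m}\gamma=\nu(\gamma)\phi$ for $\gamma\in\Gamma_0(M)$, where $(\phi|_{k,m}\gamma)(\tau,z)=(c\tau+d)^{-k}e\big(-\tfrac{mcz^2}{c\tau+d}\big)\phi\big(\tfrac{a\tau+b}{c\tau+d},\tfrac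 z{c\tau+d}\big)$; such that $\phi(\tau,z+\lambda\tau+\mu)=e(-m(\lambda^2\tau+2\lambda z))\phi(\tau,z)$ for $\lambda,\mu\in\mathbb Z$; and such that for every $g\in SL_2(\mathbb Z)$ there are an integer $h\ge1$ and coefficients $c(n,r)$ with $(\phi|_{k,m}g)(\tau,z)=\sum_{n,r\in\mathbb Z}c(n,r)\,e(\tfrac nh\tau+rz)$ and $c(n,r)=0$ unless $r^2\le 4m\tfrac nh$. * $J_{k,m}(\Gamma_0(M),\nu)^0$ is the subspace of those $\phi\in J_{k,m}(\Gamma_0(M),\nu)$ with $\phi(\tau,0)=0$ for all $\tau$, i.e. the kernel of the restriction map $D_0:\phi(\tau,z)\mapsto\phi(\tau,0)$. * $J^*_{k,m}(\Gamma_0(M),\nu)$ is the subspace of those $\phi\in J_{k,m}(\Gamma_0(M),\nu)$ whose theta decomposition $\phi(\tau,z)=\sum_{r=0}^{2m-1}h_{m,r}(\tau)\theta^J_{m,r}(\tau,z)$ has $h_{m,r}=0$ for all $r\ne0,m$, and $J^*_{k,m}(\Gamma_0(M),\nu)^0=J^*_{k,m}(\Gamma_0(M),\nu)\cap J_{k,m}(\Gamma_0(M),\nu)^0$.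 **Corollary 4.5.** The two kernel spaces $$J_{k,1}(\Gamma_0(mN),\chi)^0\qquad\text{and}\qquad J^*_{k,m}(\Gamma_0(mN),\chi\,\omega_m\overline\omega)^0$$ are isomorphic as complex vector spaces. Moreover each of them is isomorphic, as a complex vector space, to $M_{k-1}(\Gamma_0(mN),\chi\overline\omega)$. -/

import Mathlib

open UpperHalfPlane CongruenceSubgroup
open scoped MatrixGroups Manifold ModularForm Real

namespace JacobiRestriction

noncomputable section

/-! ## Theta functions and the factor of automorphy -/

/-- The automorphy factor `c τ + d` of `γ = (a, b; c, d)`. -/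
def autFactor (γ : SL(2, ℤ)) (τ : ℍ) : ℂ := (γ 1 0 : ℂ) * (τ : ℂ) + (γ 1 1 : ℂ)

/-- The theta function
`θ^J_{m,r}(τ, z) = ∑_{n ∈ ℤ} exp (2 π i m ((n + r / 2m)² τ + 2 (n + r / 2m) z))`. -/
def theta (m r : ℕ) (τ : ℍ) (z : ℂ) : ℂ :=
  ∑' n : ℤ, Complex.exp (2 * π * Complex.I * m *
    (((n : ℂ) + (r : ℂ) / (2 * m)) ^ 2 * (τ : ℂ) + 2 * ((n : ℂ) + (r : ℂ) / (2 * m)) * z))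

/-- The column vector `(θ^J_{1,0}, θ^J_{1,1})`. -/
def thetaVec (τ : ℍ) (z : ℂ) : Fin 2 → ℂ := ![theta 1 0 τ z, theta 1 1 τ z]

/-- `U` describes the transformation of the index one theta vector under `γ`:
`Θ^J(γ(τ, z)) = exp (2 π i c z² / (c τ + d)) (c τ + d)^{1/2} U Θ^J(τ, z)`
with the principal branch of the square root. -/
def IsThetaMultiplier (γ : SL(2, ℤ)) (U : Matrix (Fin 2) (Fin 2) ℂ) : Prop :=
  ∀ (τ : ℍ) (z : ℂ), thetaVec (γ • τ) (z / autFactor γ τ) =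
    (Complex.exp (2 * π * Complex.I * ((γ 1 0 : ℂ) * z ^ 2 / autFactor γ τ)) *
      autFactor γ τ ^ (1 / 2 : ℂ)) • U.mulVec (thetaVec τ z)

/-! ### Existence and uniqueness of the theta multiplier -/

lemma autFactor_eq_denom (γ : SL(2, ℤ)) (τ : ℍ) : autFactor γ τ = denom γ τ := by
  simp [autFactor, ModularGroup.denom_apply]

lemma autFactor_ne_zero (γ : SL(2, ℤ)) (τ : ℍ) : autFactor γ τ ≠ 0 := by
  rw [autFactor_eq_denom]; exact denom_ne_zero _ _

lemma coe_smul_mul_autFactor (γ : SL(2, ℤ)) (τ : ℍ) :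
    ((γ • τ : ℍ) : ℂ) * autFactor γ τ = (γ 0 0 : ℂ) * τ + (γ 0 1 : ℂ) := by
  have h := autFactor_ne_zero γ τ
  rw [coe_specialLinearGroup_apply]
  simp only [autFactor] at *
  simp only [algebraMap_int_eq, eq_intCast, Complex.ofReal_intCast]
  exact div_mul_cancel₀ _ h

lemma autFactor_mul (γ δ : SL(2, ℤ)) (τ : ℍ) :
    autFactor (γ * δ) τ = autFactor γ (δ • τ) * autFactor δ τ := by
  have h := coe_smul_mul_autFactor δ τ
  have e : autFactor γ (δ • τ) * autFactor δ τ =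
      (γ 1 0 : ℂ) * (((δ • τ : ℍ) : ℂ) * autFactor δ τ) + (γ 1 1 : ℂ) * autFactor δ τ := by
    simp only [autFactor]; ring
  rw [e, h]
  simp only [autFactor, Matrix.SpecialLinearGroup.coe_mul, Matrix.mul_apply, Fin.sum_univ_two]
  push_cast
  ring

lemma continuous_autFactor (γ : SL(2, ℤ)) : Continuous (autFactor γ) := by
  unfold autFactor
  fun_prop

lemma sqrt_sq (w : ℂ) : (w ^ (1 / 2 : ℂ)) ^ 2 = w := by
  have := Complex.cpow_nat_inv_pow w (n := 2) two_ne_zero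
  simpa only [one_div, Nat.cast_ofNat] using this

lemma sqrt_ne_zero {w : ℂ} (hw : w ≠ 0) : w ^ (1 / 2 : ℂ) ≠ 0 := by
  intro h
  apply hw
  rw [← sqrt_sq w, h]
  simp

/-- A continuous function on the upper half-plane with constant nonzero square is constant. -/
lemma const_of_sq {q : ℍ → ℂ} (hq : Continuous q) {c : ℂ} (hc : c ≠ 0) (h : ∀ τ, q τ ^ 2 = c) :
    ∃ κ : ℂ, κ ^ 2 = c ∧ ∀ τ, q τ = κ := by
  refine ⟨q I, h I, fun τ => ?_⟩
  have hne : q I ≠ 0 := fun h0 => hc (by rw [← h I, h0]; simp)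
  have := isPreconnected_univ.eq_or_eq_neg_of_sq_eq (f := q) (g := fun _ => q I)
    hq.continuousOn continuousOn_const (fun x _ => by simp [h]) (fun {x} _ => hne)
  rcases this with h1 | h1
  · exact h1 (Set.mem_univ τ)
  · have := h1 (Set.mem_univ I)
    simp only [Pi.neg_apply] at this
    exact absurd (self_eq_neg.mp this) hne

lemma continuous_sqrt_autFactor (γ : SL(2, ℤ)) :
    Continuous (fun τ : ℍ => autFactor γ τ ^ (1 / 2 : ℂ)) := by
  by_cases hc : γ 1 0 = 0
  · have : ∀ τ, autFactor γ τ = (γ 1 1 : ℂ) := fun τ => by simp [autFactor, hc]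
    simp only [this]
    exact continuous_const
  · refine continuous_iff_continuousAt.mpr fun τ => ?_
    refine (continuous_autFactor γ).continuousAt.cpow continuousAt_const ?_
    right
    have : (autFactor γ τ).im = γ 1 0 * τ.im := by simp [autFactor]
    rw [this]
    exact mul_ne_zero (by exact_mod_cast hc) τ.im_ne_zero

lemma isThetaMultiplier_mul {γ δ : SL(2, ℤ)} {U V : Matrix (Fin 2) (Fin 2) ℂ}
    (hU : IsThetaMultiplier γ U) (hV : IsThetaMultiplier δ V) :
    ∃ ε : ℂ, ε ^ 2 = 1 ∧ IsThetaMultiplier (γ * δ) (ε • (U * V)) := by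
  have hδ : Continuous fun τ : ℍ => δ • τ :=
    continuous_const_smul (Matrix.SpecialLinearGroup.mapGL ℝ δ)
  obtain ⟨ε, hε, h⟩ := const_of_sq (q := fun τ : ℍ =>
      autFactor γ (δ • τ) ^ (1 / 2 : ℂ) * autFactor δ τ ^ (1 / 2 : ℂ) /
        autFactor (γ * δ) τ ^ (1 / 2 : ℂ))
    ((((continuous_sqrt_autFactor γ).comp hδ).mul (continuous_sqrt_autFactor δ)).div
      (continuous_sqrt_autFactor _) fun τ => sqrt_ne_zero (autFactor_ne_zero _ _))
    one_ne_zero (fun τ => by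
      have := autFactor_ne_zero (γ * δ) τ
      rw [div_pow, mul_pow, sqrt_sq, sqrt_sq, sqrt_sq, ← autFactor_mul, div_self this])
  refine ⟨ε, hε, fun τ z => ?_⟩
  have e1 : z / autFactor (γ * δ) τ = z / autFactor δ τ / autFactor γ (δ • τ) := by
    rw [autFactor_mul, div_div, mul_comm]
  have h1 := (div_eq_iff (sqrt_ne_zero (autFactor_ne_zero (γ * δ) τ))).mp (h τ)
  rw [e1, mul_smul, hU, hV, Matrix.mulVec_smul, smul_smul, Matrix.smul_mulVec, smul_smul,
    Matrix.mulVec_mulVec]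
  congr 1
  have e2 : (γ 1 0 : ℂ) * (z / autFactor δ τ) ^ 2 / autFactor γ (δ • τ) +
      (δ 1 0 : ℂ) * z ^ 2 / autFactor δ τ =
      ((γ * δ) 1 0 : ℂ) * z ^ 2 / autFactor (γ * δ) τ := by
    have d1 := autFactor_ne_zero γ (δ • τ)
    have d2 := autFactor_ne_zero δ τ
    have key : (γ 1 0 : ℂ) + (δ 1 0 : ℂ) * autFactor (γ * δ) τ =
        ((γ * δ) 1 0 : ℂ) * autFactor δ τ := by
      have hdet : (δ 0 0 : ℂ) * δ 1 1 - δ 0 1 * δ 1 0 = 1 := by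
        have := Matrix.det_fin_two δ.1
        rw [δ.2] at this
        exact_mod_cast this.symm
      simp only [autFactor, Matrix.SpecialLinearGroup.coe_mul, Matrix.mul_apply,
        Fin.sum_univ_two]
      push_cast
      linear_combination (-(γ 1 0 : ℂ)) * hdet
    rw [autFactor_mul] at key ⊢
    field_simp
    linear_combination z ^ 2 * key
  rw [← e2, mul_add, Complex.exp_add, mul_assoc _ _ ε, mul_comm _ ε, ← h1]
  ring

lemma isThetaMultiplier_one : IsThetaMultiplier 1 1 := by
  intro τ z
  simp [autFactor]

lemma theta_zero_eq (τ : ℍ) (z : ℂ) : theta 1 0 τ z = jacobiTheta₂ (2 * z) (2 * τ) := by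
  unfold theta jacobiTheta₂ jacobiTheta₂_term
  refine tsum_congr fun n => ?_
  congr 1
  push_cast
  ring

lemma theta_one_eq (τ : ℍ) (z : ℂ) : theta 1 1 τ z =
    Complex.exp (π * Complex.I * τ / 2 + 2 * π * Complex.I * z) *
      jacobiTheta₂ (2 * z + τ) (2 * τ) := by
  unfold theta jacobiTheta₂ jacobiTheta₂_term
  rw [← tsum_mul_left]
  refine tsum_congr fun n => ?_
  rw [← Complex.exp_add]
  congr 1
  push_cast
  ring

lemma theta_add (τ : ℍ) (z : ℂ) : theta 1 0 τ z + theta 1 1 τ z = jacobiTheta₂ z (τ / 2) := by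
  have hτ : 0 < ((τ : ℂ) / 2).im := by
    have := τ.im_pos
    simp only [Complex.div_ofNat_im, coe_im]; positivity
  have h2τ : 0 < (2 * (τ : ℂ)).im := by simpa using τ.im_pos
  have hs := hasSum_jacobiTheta₂_term z hτ
  have h0 := hasSum_jacobiTheta₂_term (2 * z) h2τ
  have h1 := (hasSum_jacobiTheta₂_term (2 * z + τ) h2τ).mul_left
    (Complex.exp (π * Complex.I * τ / 2 + 2 * π * Complex.I * z))
  rw [theta_zero_eq, theta_one_eq]
  refine HasSum.unique ?_ hs
  have hc : IsCompl (Set.range fun n : ℤ => 2 * n) (Set.range fun n : ℤ => 2 * n + 1) := by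
    rw [range_two_mul, range_two_mul_add_one]
    exact Int.isCompl_even_odd
  have hi0 : Function.Injective fun n : ℤ => 2 * n := fun a b h => by simpa using h
  have hi1 : Function.Injective fun n : ℤ => 2 * n + 1 := fun a b h => by simpa using h
  refine HasSum.add_isCompl hc ?_ ?_
  · rw [Function.comp_def, Function.Injective.hasSum_range_iff (f := fun n => jacobiTheta₂_term n z (τ / 2)) hi0]
    refine h0.congr_fun fun n => ?_
    simp only [Function.comp_apply, jacobiTheta₂_term]
    congr 1
    push_cast
    ring
  · rw [Function.comp_def, Function.Injective.hasSum_range_iff (f := fun n => jacobiTheta₂_term n z (τ / 2)) hi1]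
    refine h1.congr_fun fun n => ?_
    simp only [Function.comp_apply, jacobiTheta₂_term]
    rw [← Complex.exp_add]
    congr 1
    push_cast
    ring

lemma theta_add' (τ : ℍ) (z : ℂ) :
    theta 1 0 τ (z + 1 / 2) = theta 1 0 τ z ∧ theta 1 1 τ (z + 1 / 2) = - theta 1 1 τ z := by
  constructor
  · rw [theta_zero_eq, theta_zero_eq, mul_add, mul_one_div_cancel two_ne_zero,
      jacobiTheta₂_add_left]
  · rw [theta_one_eq, theta_one_eq, show 2 * (z + 1 / 2) + (τ : ℂ) = 2 * z + τ + 1 by ring,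
      jacobiTheta₂_add_left, show π * Complex.I * τ / 2 + 2 * π * Complex.I * (z + 1 / 2) =
        (π * Complex.I * τ / 2 + 2 * π * Complex.I * z) + π * Complex.I by ring, Complex.exp_add,
      Complex.exp_pi_mul_I]
    ring

lemma exists_isThetaMultiplier_S : ∃ U, IsThetaMultiplier ModularGroup.S U := by
  have haut : ∀ τ : ℍ, autFactor ModularGroup.S τ = τ := fun τ => by
    simp [autFactor, ModularGroup.S]
  have hS : ∀ τ : ℍ, ((ModularGroup.S • τ : ℍ) : ℂ) = -1 / τ := fun τ => by
    rw [modular_S_smul]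
    simp [neg_div, inv_neg]
  have hτ0 : ∀ τ : ℍ, (τ : ℂ) ≠ 0 := fun τ => ne_zero τ
  have hslit : ∀ (a : ℝ) (τ : ℍ), 0 < a → -Complex.I * (a * (τ : ℂ)) ∈ Complex.slitPlane := by
    intro a τ ha
    left
    have := τ.im_pos
    simpa using mul_pos ha this
  -- the ratio of the two square roots occurring in the inversion formula is constant
  have hratio : ∀ a : ℝ, 0 < a → ∃ κ : ℂ, ∀ τ : ℍ,
      (-Complex.I * (a * (τ : ℂ))) ^ (1 / 2 : ℂ) = κ * (τ : ℂ) ^ (1 / 2 : ℂ) := by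
    intro a ha
    have hcont := continuous_sqrt_autFactor ModularGroup.S
    simp only [haut] at hcont
    obtain ⟨κ, -, h⟩ := const_of_sq
      (q := fun τ : ℍ => (-Complex.I * (a * (τ : ℂ))) ^ (1 / 2 : ℂ) / (τ : ℂ) ^ (1 / 2 : ℂ))
      (c := -Complex.I * a)
      (Continuous.div (continuous_iff_continuousAt.mpr fun τ =>
        ContinuousAt.cpow (by fun_prop) continuousAt_const (hslit a τ ha)) hcont
          fun τ => sqrt_ne_zero (hτ0 τ))
      (by simp [ha.ne']) (fun τ => by
        have := hτ0 τ
        rw [div_pow, sqrt_sq, sqrt_sq]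
        field_simp)
    exact ⟨κ, fun τ => (div_eq_iff (sqrt_ne_zero (hτ0 τ))).mp (h τ)⟩
  obtain ⟨κ, hκ⟩ := hratio (1 / 2) (by norm_num)
  obtain ⟨μ, hμ⟩ := hratio 2 (by norm_num)
  have h0 : ∀ (τ : ℍ) (z : ℂ), theta 1 0 (ModularGroup.S • τ) (z / τ) =
      κ * (τ : ℂ) ^ (1 / 2 : ℂ) * Complex.exp (2 * π * Complex.I * (z ^ 2 / τ)) *
        (theta 1 0 τ z + theta 1 1 τ z) := by
    intro τ z
    have hne : (-Complex.I * ((τ : ℂ) / 2)) ^ (1 / 2 : ℂ) ≠ 0 :=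
      sqrt_ne_zero (by simp [hτ0])
    have hroot : (-Complex.I * ((τ : ℂ) / 2)) ^ (1 / 2 : ℂ) = κ * (τ : ℂ) ^ (1 / 2 : ℂ) := by
      rw [← hκ τ]; congr 2; push_cast; ring
    rw [theta_add, jacobiTheta₂_functional_equation z (τ / 2), theta_zero_eq, hS, ← hroot]
    have hexp : Complex.exp (2 * π * Complex.I * (z ^ 2 / τ)) *
        Complex.exp (-π * Complex.I * z ^ 2 / (τ / 2)) = 1 := by
      rw [← Complex.exp_add, Complex.exp_eq_one_iff]
      refine ⟨0, ?_⟩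
      have := hτ0 τ
      field_simp
      ring
    have e1 : z / ((τ : ℂ) / 2) = 2 * (z / τ) := by have := hτ0 τ; field_simp
    have e2 : -1 / ((τ : ℂ) / 2) = 2 * (-1 / τ) := by have := hτ0 τ; field_simp
    rw [e1, e2]
    have hinv := mul_one_div_cancel hne
    linear_combination (-(jacobiTheta₂ (2 * (z / τ)) (2 * (-1 / τ)))) *
      (((-Complex.I * ((τ : ℂ) / 2)) ^ (1 / 2 : ℂ) *
        (1 / (-Complex.I * ((τ : ℂ) / 2)) ^ (1 / 2 : ℂ))) * hexp + hinv)
  have h1 : ∀ (τ : ℍ) (z : ℂ), theta 1 0 (ModularGroup.S • τ) (z / τ) +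
      theta 1 1 (ModularGroup.S • τ) (z / τ) =
      μ * (τ : ℂ) ^ (1 / 2 : ℂ) * Complex.exp (2 * π * Complex.I * (z ^ 2 / τ)) *
        theta 1 0 τ z := by
    intro τ z
    have hne : (-Complex.I * (2 * (τ : ℂ))) ^ (1 / 2 : ℂ) ≠ 0 :=
      sqrt_ne_zero (by simp [hτ0])
    have hroot : (-Complex.I * (2 * (τ : ℂ))) ^ (1 / 2 : ℂ) = μ * (τ : ℂ) ^ (1 / 2 : ℂ) := by
      rw [← hμ τ]; congr 2
    rw [theta_add, theta_zero_eq, jacobiTheta₂_functional_equation (2 * z) (2 * τ), hS, ← hroot]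
    have hexp : Complex.exp (2 * π * Complex.I * (z ^ 2 / τ)) *
        Complex.exp (-π * Complex.I * (2 * z) ^ 2 / (2 * τ)) = 1 := by
      rw [← Complex.exp_add, Complex.exp_eq_one_iff]
      refine ⟨0, ?_⟩
      have := hτ0 τ
      field_simp
      ring
    have e1 : 2 * z / (2 * (τ : ℂ)) = z / τ := by have := hτ0 τ; field_simp
    have e2 : -1 / (2 * (τ : ℂ)) = -1 / τ / 2 := by have := hτ0 τ; field_simp
    rw [e1, e2]
    have hinv := mul_one_div_cancel hne
    linear_combination (-(jacobiTheta₂ (z / τ) (-1 / τ / 2))) *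
      (((-Complex.I * (2 * (τ : ℂ))) ^ (1 / 2 : ℂ) *
        (1 / (-Complex.I * (2 * (τ : ℂ))) ^ (1 / 2 : ℂ))) * hexp + hinv)
  refine ⟨!![κ, κ; μ - κ, -κ], fun τ z => ?_⟩
  have hc : ((ModularGroup.S 1 0 : ℤ) : ℂ) = 1 := by simp [ModularGroup.S]
  have h1' := h1 τ z
  have h2 := eq_sub_of_add_eq' h1'
  rw [haut, hc, one_mul, thetaVec, h2, h0]
  ext i
  fin_cases i
  · simp [thetaVec]
    ring
  · simp [thetaVec]
    ring

lemma exists_isThetaMultiplier_T_zpow (k : ℤ) :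
    ∃ U, IsThetaMultiplier (ModularGroup.T ^ k) U := by
  have haut : ∀ τ : ℍ, autFactor (ModularGroup.T ^ k) τ = 1 := fun τ => by
    simp [autFactor, ModularGroup.coe_T_zpow]
  refine ⟨!![1, 0; 0, Complex.exp (2 * π * Complex.I * (k / 4))], fun τ z => ?_⟩
  have hc : (((ModularGroup.T ^ k) 1 0 : ℤ) : ℂ) = 0 := by simp [ModularGroup.coe_T_zpow]
  rw [haut, hc, div_one, thetaVec]
  have hper : ∀ n : ℤ, Complex.exp (2 * π * Complex.I * n) = 1 := fun n => by
    rw [Complex.exp_eq_one_iff]; exact ⟨n, by ring⟩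
  have h0 : theta 1 0 (ModularGroup.T ^ k • τ) z = theta 1 0 τ z := by
    unfold theta
    refine tsum_congr fun n => ?_
    rw [ModularGroup.coe_T_zpow_smul_eq]
    rw [← mul_one (Complex.exp (_ * (_ * (τ : ℂ) + _))), ← hper (n ^ 2 * k), ← Complex.exp_add]
    congr 1
    push_cast
    ring
  have h1 : theta 1 1 (ModularGroup.T ^ k • τ) z =
      Complex.exp (2 * π * Complex.I * (k / 4)) * theta 1 1 τ z := by
    unfold theta
    rw [← tsum_mul_left]
    refine tsum_congr fun n => ?_
    rw [ModularGroup.coe_T_zpow_smul_eq]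
    rw [← one_mul (Complex.exp (2 * π * Complex.I * (k / 4)) * _), ← hper ((n ^ 2 + n) * k),
      ← Complex.exp_add, ← Complex.exp_add]
    congr 1
    push_cast
    ring
  rw [h0, h1]
  ext i
  fin_cases i
  · simp [thetaVec]
  · simp [thetaVec]
    ring

lemma exists_isThetaMultiplier (γ : SL(2, ℤ)) : ∃ U, IsThetaMultiplier γ U := by
  have hmul : ∀ γ δ : SL(2, ℤ), (∃ U, IsThetaMultiplier γ U) → (∃ U, IsThetaMultiplier δ U) →
      ∃ U, IsThetaMultiplier (γ * δ) U := by
    rintro γ δ ⟨U, hU⟩ ⟨V, hV⟩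
    obtain ⟨ε, -, h⟩ := isThetaMultiplier_mul hU hV
    exact ⟨_, h⟩
  have hγ : γ ∈ Subgroup.closure {ModularGroup.S, ModularGroup.T} := by
    rw [SpecialLinearGroup.SL2Z_generators]; trivial
  induction hγ using Subgroup.closure_induction'' with
  | one => exact ⟨1, isThetaMultiplier_one⟩
  | mem x hx =>
    rcases hx with rfl | rfl
    · exact exists_isThetaMultiplier_S
    · simpa using exists_isThetaMultiplier_T_zpow 1
  | inv_mem x hx =>
    rcases hx with rfl | rfl
    · have : ModularGroup.S⁻¹ = ModularGroup.S * (ModularGroup.S * ModularGroup.S) := by decide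
      rw [this]
      exact hmul _ _ exists_isThetaMultiplier_S
        (hmul _ _ exists_isThetaMultiplier_S exists_isThetaMultiplier_S)
    · simpa using exists_isThetaMultiplier_T_zpow (-1)
  | mul x y _ _ hx hy => exact hmul x y hx hy

lemma hasSum_theta_zero (τ : ℍ) (z : ℂ) :
    Summable fun n : ℤ => Complex.exp (2 * π * Complex.I * (1 : ℕ) *
      (((n : ℂ) + ((0 : ℕ) : ℂ) / (2 * (1 : ℕ))) ^ 2 * (τ : ℂ) +
        2 * ((n : ℂ) + ((0 : ℕ) : ℂ) / (2 * (1 : ℕ))) * z)) := by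
  have h2τ : 0 < (2 * (τ : ℂ)).im := by simpa using τ.im_pos
  refine ((hasSum_jacobiTheta₂_term (2 * z) h2τ).summable).congr fun n => ?_
  unfold jacobiTheta₂_term
  congr 1
  push_cast
  ring

lemma hasSum_theta_one (τ : ℍ) (z : ℂ) :
    Summable fun n : ℤ => Complex.exp (2 * π * Complex.I * (1 : ℕ) *
      (((n : ℂ) + ((1 : ℕ) : ℂ) / (2 * (1 : ℕ))) ^ 2 * (τ : ℂ) +
        2 * ((n : ℂ) + ((1 : ℕ) : ℂ) / (2 * (1 : ℕ))) * z)) := by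
  have h2τ : 0 < (2 * (τ : ℂ)).im := by simpa using τ.im_pos
  refine (((hasSum_jacobiTheta₂_term (2 * z + τ) h2τ).summable).mul_left
    (Complex.exp (π * Complex.I * τ / 2 + 2 * π * Complex.I * z))).congr fun n => ?_
  unfold jacobiTheta₂_term
  rw [← Complex.exp_add]
  congr 1
  push_cast
  ring

lemma theta_I_ne_zero {r : ℕ} (hs : Summable fun n : ℤ =>
      Complex.exp (2 * π * Complex.I * (1 : ℕ) *
        (((n : ℂ) + (r : ℂ) / (2 * (1 : ℕ))) ^ 2 * ((I : ℍ) : ℂ) +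
          2 * ((n : ℂ) + (r : ℂ) / (2 * (1 : ℕ))) * 0))) :
    theta 1 r I 0 ≠ 0 := by
  have hterm : ∀ n : ℤ, Complex.exp (2 * π * Complex.I * (1 : ℕ) *
        (((n : ℂ) + (r : ℂ) / (2 * (1 : ℕ))) ^ 2 * ((I : ℍ) : ℂ) +
          2 * ((n : ℂ) + (r : ℂ) / (2 * (1 : ℕ))) * 0)) =
      ((Real.exp (-(2 * π * ((n : ℝ) + (r : ℝ) / 2) ^ 2)) : ℝ) : ℂ) := by
    intro n
    rw [Complex.ofReal_exp]
    congr 1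
    push_cast
    linear_combination (2 * π * ((n : ℂ) + (r : ℂ) / 2) ^ 2) * Complex.I_sq
  unfold theta
  simp only [hterm] at hs ⊢
  rw [Complex.summable_ofReal] at hs
  rw [← Complex.ofReal_tsum]
  exact_mod_cast (hs.tsum_pos (fun n => (Real.exp_pos _).le) 0 (Real.exp_pos _)).ne'

lemma isThetaMultiplier_unique {γ : SL(2, ℤ)} {U V : Matrix (Fin 2) (Fin 2) ℂ}
    (hU : IsThetaMultiplier γ U) (hV : IsThetaMultiplier γ V) : U = V := by
  have hUV : ∀ τ z, U.mulVec (thetaVec τ z) = V.mulVec (thetaVec τ z) := by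
    intro τ z
    have h := (hU τ z).symm.trans (hV τ z)
    exact smul_right_injective _ (mul_ne_zero (Complex.exp_ne_zero _)
      (sqrt_ne_zero (autFactor_ne_zero γ τ))) h
  have h0 : theta 1 0 I 0 ≠ 0 := theta_I_ne_zero (hasSum_theta_zero I 0)
  have h1 : theta 1 1 I 0 ≠ 0 := theta_I_ne_zero (hasSum_theta_one I 0)
  have key : ∀ i : Fin 2, U i 0 = V i 0 ∧ U i 1 = V i 1 := by
    intro i
    have a := congrFun (hUV I 0) i
    have b := congrFun (hUV I (0 + 1 / 2)) i
    simp only [thetaVec, (theta_add' I 0).1, (theta_add' I 0).2] at a b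
    simp only [Matrix.mulVec, dotProduct, Fin.sum_univ_two, Matrix.cons_val_zero,
      Matrix.cons_val_one] at a b
    constructor
    · apply mul_right_cancel₀ h0
      linear_combination (a + b) / 2
    · apply mul_right_cancel₀ h1
      linear_combination (a - b) / 2
  ext i j
  fin_cases j
  · exact (key i).1
  · exact (key i).2

/-- The matrix `U₁(γ)` of the transformation of the theta vector `(θ^J_{1,0}, θ^J_{1,1})`. -/
def thetaMultiplier (γ : SL(2, ℤ)) : Matrix (Fin 2) (Fin 2) ℂ :=
  (exists_isThetaMultiplier γ).choose

lemma thetaMultiplier_spec (γ : SL(2, ℤ)) : IsThetaMultiplier γ (thetaMultiplier γ) :=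
  (exists_isThetaMultiplier γ).choose_spec

/-! ## Characters -/

/-- The character `γ ↦ det U₁(γ)` of `SL(2, ℤ)`. -/
def detThetaMultiplier : SL(2, ℤ) →* ℂ where
  toFun γ := (thetaMultiplier γ).det
  map_one' := by
    rw [isThetaMultiplier_unique (thetaMultiplier_spec 1) isThetaMultiplier_one, Matrix.det_one]
  map_mul' γ δ := by
    obtain ⟨ε, hε, h⟩ := isThetaMultiplier_mul (thetaMultiplier_spec γ) (thetaMultiplier_spec δ)
    rw [isThetaMultiplier_unique (thetaMultiplier_spec (γ * δ)) h, Matrix.det_smul,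
      Matrix.det_mul, Fintype.card_fin, hε, one_mul]

lemma dvd_of_mem_Gamma0 {m : ℕ} (γ : Gamma0 m) : (m : ℤ) ∣ (γ : SL(2, ℤ)) 1 0 := by
  have h := Gamma0_mem.mp γ.2
  rwa [ZMod.intCast_zmod_eq_zero_iff_dvd] at h

/-- The map `γ = (a, b; c, d) ↦ γ_m = (a, b m; c / m, d)` from `Γ₀(m)` to `SL(2, ℤ)`. -/
def conjGamma0 (m : ℕ) (γ : Gamma0 m) : SL(2, ℤ) :=
  ⟨!![(γ : SL(2, ℤ)) 0 0, (γ : SL(2, ℤ)) 0 1 * m;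
      (γ : SL(2, ℤ)) 1 0 / m, (γ : SL(2, ℤ)) 1 1], by
    have hdet := Matrix.det_fin_two (γ : SL(2, ℤ)).1
    rw [(γ : SL(2, ℤ)).2] at hdet
    have h := Int.mul_ediv_cancel' (dvd_of_mem_Gamma0 γ)
    rw [Matrix.det_fin_two_of]
    linear_combination (-(γ : SL(2, ℤ)) 0 1) * h - hdet⟩

lemma conjGamma0_mul (m : ℕ) (γ δ : Gamma0 m) :
    conjGamma0 m (γ * δ) = conjGamma0 m γ * conjGamma0 m δ := by
  obtain ⟨x, hx⟩ := dvd_of_mem_Gamma0 γ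
  obtain ⟨y, hy⟩ := dvd_of_mem_Gamma0 δ
  have hxy : (γ * δ : Gamma0 m).1 1 0 = m * (x * (δ : SL(2, ℤ)) 0 0 + (γ : SL(2, ℤ)) 1 1 * y) := by
    simp only [Subgroup.coe_mul, Matrix.SpecialLinearGroup.coe_mul, Matrix.mul_apply,
      Fin.sum_univ_two]
    rw [hx, hy]
    ring
  ext i j
  rw [Matrix.SpecialLinearGroup.coe_mul]
  rcases eq_or_ne m 0 with rfl | hm
  · fin_cases i <;> fin_cases j <;>
      simp [conjGamma0, Matrix.mul_apply, Fin.sum_univ_two, hx, hy]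
  · have hm' : (m : ℤ) ≠ 0 := by exact_mod_cast hm
    simp only [conjGamma0, hxy, hx, hy, Int.mul_ediv_cancel_left _ hm']
    fin_cases i <;> fin_cases j <;>
      simp [Matrix.mul_apply, Fin.sum_univ_two, hx, hy] <;> ring

/-- The character `ω_m(γ) = det U₁(γ_m)` of `Γ₀(m)`. -/
def omega (m : ℕ) : Gamma0 m →* ℂ where
  toFun γ := detThetaMultiplier (conjGamma0 m γ)
  map_one' := by
    have : conjGamma0 m 1 = 1 := by
      ext i j
      fin_cases i <;> fin_cases j <;> simp [conjGamma0]
    rw [this, map_one]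
  map_mul' γ δ := by rw [conjGamma0_mul, map_mul]

lemma Gamma0_le_of_dvd {m M : ℕ} (h : m ∣ M) : Gamma0 M ≤ Gamma0 m := by
  intro γ hγ
  rw [Gamma0_mem, ZMod.intCast_zmod_eq_zero_iff_dvd] at *
  exact (Int.natCast_dvd_natCast.mpr h).trans hγ

/-- The restriction of a character of `Γ₀(m)` to the subgroup `Γ₀(M)`, for `m ∣ M`. -/
def restrictChar {m M : ℕ} (h : m ∣ M) (ν : Gamma0 m →* ℂ) : Gamma0 M →* ℂ :=
  ν.comp (Subgroup.inclusion (Gamma0_le_of_dvd h))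

/-- The complex conjugate of a character. -/
def conjChar {M : ℕ} (ν : Gamma0 M →* ℂ) : Gamma0 M →* ℂ :=
  ((starRingEnd ℂ : ℂ →+* ℂ) : ℂ →* ℂ).comp ν

/-- The character `(a, b; c, d) ↦ χ(d)` of `Γ₀(M)` given by a Dirichlet character `χ` modulo `M`. -/
def dirichletChar {M : ℕ} (χ : DirichletCharacter ℂ M) : Gamma0 M →* ℂ :=
  χ.toMonoidHom.comp (Gamma0Map M)

/-! ## Jacobi forms -/

/-- The weight `k`, index `m` action of `γ = (a, b; c, d)` on functions on `ℍ × ℂ`: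
`(c τ + d)^{-k} exp (-2 π i m c z² / (c τ + d)) φ((a τ + b) / (c τ + d), z / (c τ + d))`. -/
def jacobiSlash (k : ℤ) (m : ℕ) (γ : SL(2, ℤ)) (φ : ℍ → ℂ → ℂ) (τ : ℍ) (z : ℂ) : ℂ :=
  autFactor γ τ ^ (-k) *
    Complex.exp (-(2 * π * Complex.I * m * ((γ 1 0 : ℂ) * z ^ 2 / autFactor γ τ))) *
      φ (γ • τ) (z / autFactor γ τ)

/-- `φ` has an (absolutely convergent) Fourier expansion
`φ(τ, z) = ∑ c(n, r) exp (2 π i (n τ / h + r z))` over integers `n`, `r`, for some `h ≥ 1`,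
with `c(n, r) = 0` unless `r² ≤ 4 m (n / h)`. -/
def HasJacobiExpansion (m : ℕ) (φ : ℍ → ℂ → ℂ) : Prop :=
  ∃ (h : ℕ) (c : ℤ × ℤ → ℂ), 0 < h ∧
    (∀ n r : ℤ, c (n, r) ≠ 0 → (h : ℤ) * r ^ 2 ≤ 4 * m * n) ∧
    ∀ (τ : ℍ) (z : ℂ), HasSum (fun p : ℤ × ℤ =>
      c p * Complex.exp (2 * π * Complex.I * ((p.1 : ℂ) / h * τ + p.2 * z))) (φ τ z)

lemma HasJacobiExpansion.rescale {m h : ℕ} {φ : ℍ → ℂ → ℂ} {c : ℤ × ℤ → ℂ} (hh : 0 < h)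
    (hc : ∀ n r : ℤ, c (n, r) ≠ 0 → (h : ℤ) * r ^ 2 ≤ 4 * m * n)
    (hs : ∀ (τ : ℍ) (z : ℂ), HasSum (fun p : ℤ × ℤ =>
      c p * Complex.exp (2 * π * Complex.I * ((p.1 : ℂ) / h * τ + p.2 * z))) (φ τ z))
    (l : ℕ) (hl : 0 < l) :
    ∃ c' : ℤ × ℤ → ℂ,
      (∀ n r : ℤ, c' (n, r) ≠ 0 → ((h * l : ℕ) : ℤ) * r ^ 2 ≤ 4 * m * n) ∧
      ∀ (τ : ℍ) (z : ℂ), HasSum (fun p : ℤ × ℤ =>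
        c' p * Complex.exp (2 * π * Complex.I * ((p.1 : ℂ) / (h * l : ℕ) * τ + p.2 * z)))
          (φ τ z) := by
  classical
  have hl' : (l : ℤ) ≠ 0 := by exact_mod_cast hl.ne'
  refine ⟨fun p => if (l : ℤ) ∣ p.1 then c (p.1 / l, p.2) else 0, fun n r hn => ?_,
    fun τ z => ?_⟩
  · by_cases hd : (l : ℤ) ∣ n
    · simp only [hd, if_true] at hn
      obtain ⟨n', rfl⟩ := hd
      rw [Int.mul_ediv_cancel_left _ hl'] at hn
      have := mul_le_mul_of_nonneg_left (hc _ _ hn) (Int.natCast_nonneg l)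
      push_cast
      linarith
    · simp [hd] at hn
  · have hi : Function.Injective fun p : ℤ × ℤ => ((l : ℤ) * p.1, p.2) := by
      rintro ⟨a, b⟩ ⟨a', b'⟩ hab
      simpa [hl', hl.ne'] using hab
    rw [← hi.hasSum_iff]
    · refine (hs τ z).congr_fun fun p => ?_
      have h1 : (l : ℂ) ≠ 0 := by exact_mod_cast hl.ne'
      have h2 : (h : ℂ) ≠ 0 := by exact_mod_cast hh.ne'
      simp only [Function.comp_apply, dvd_mul_right, if_true, Int.mul_ediv_cancel_left _ hl']
      congr 4
      push_cast
      field_simp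
    · rintro ⟨n, r⟩ hp
      have : ¬ (l : ℤ) ∣ n := by
        rintro ⟨n', rfl⟩
        exact hp ⟨(n', r), rfl⟩
      simp [this]

lemma HasJacobiExpansion.add {m : ℕ} {φ ψ : ℍ → ℂ → ℂ} (hφ : HasJacobiExpansion m φ)
    (hψ : HasJacobiExpansion m ψ) : HasJacobiExpansion m (φ + ψ) := by
  obtain ⟨h, c, hh, hc, hs⟩ := hφ
  obtain ⟨l, d, hl, hd, ht⟩ := hψ
  obtain ⟨c', hc', hs'⟩ := HasJacobiExpansion.rescale hh hc hs l hl
  obtain ⟨d', hd', ht'⟩ := HasJacobiExpansion.rescale hl hd ht h hh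
  rw [mul_comm l h] at hd' ht'
  refine ⟨h * l, c' + d', Nat.mul_pos hh hl, fun n r hn => ?_, fun τ z => ?_⟩
  · by_cases h0 : c' (n, r) = 0
    · refine hd' n r fun h1 => hn ?_
      simp [h0, h1]
    · exact hc' n r h0
  · refine ((hs' τ z).add (ht' τ z)).congr_fun fun p => ?_
    simp only [Pi.add_apply]
    ring

lemma HasJacobiExpansion.smul {m : ℕ} {φ : ℍ → ℂ → ℂ} (a : ℂ) (hφ : HasJacobiExpansion m φ) :
    HasJacobiExpansion m (a • φ) := by
  obtain ⟨h, c, hh, hc, hs⟩ := hφ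
  refine ⟨h, a • c, hh, fun n r hn => hc n r fun h0 => hn (by simp [h0]), fun τ z => ?_⟩
  refine ((hs τ z).mul_left a).congr_fun fun p => ?_
  simp only [Pi.smul_apply, smul_eq_mul]
  ring

lemma jacobiSlash_add (k : ℤ) (m : ℕ) (γ : SL(2, ℤ)) (φ ψ : ℍ → ℂ → ℂ) :
    jacobiSlash k m γ (φ + ψ) = jacobiSlash k m γ φ + jacobiSlash k m γ ψ := by
  ext τ z
  simp only [jacobiSlash, Pi.add_apply]
  ring

lemma jacobiSlash_smul (k : ℤ) (m : ℕ) (γ : SL(2, ℤ)) (a : ℂ) (φ : ℍ → ℂ → ℂ) :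
    jacobiSlash k m γ (a • φ) = a • jacobiSlash k m γ φ := by
  ext τ z
  simp only [jacobiSlash, Pi.smul_apply, smul_eq_mul]
  ring

/-- The space `J_{k,m}(Γ₀(M), ν)` of Jacobi forms of weight `k`, index `m` and character `ν` for
the Jacobi group `Γ₀(M) ⋉ ℤ²`: holomorphic functions on `ℍ × ℂ` with the transformation behaviour
under `Γ₀(M)` and under `ℤ²`, and holomorphic at all cusps. -/
def jacobiForms (k : ℤ) (m M : ℕ) (ν : Gamma0 M →* ℂ) : Submodule ℂ (ℍ → ℂ → ℂ) where
  carrier := {φ |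
    DifferentiableOn ℂ (fun p : ℂ × ℂ => φ (ofComplex p.1) p.2) {p | 0 < p.1.im} ∧
    (∀ γ : Gamma0 M, jacobiSlash k m γ φ = ν γ • φ) ∧
    (∀ (l u : ℤ) (τ : ℍ) (z : ℂ), φ τ (z + l * τ + u) =
      Complex.exp (-(2 * π * Complex.I * m * ((l : ℂ) ^ 2 * τ + 2 * l * z))) * φ τ z) ∧
    (∀ g : SL(2, ℤ), HasJacobiExpansion m (jacobiSlash k m g φ))}
  zero_mem' := by
    refine ⟨by simp, fun γ => ?_, fun l u τ z => by simp, fun g => ⟨1, 0, one_pos, ?_, ?_⟩⟩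
    · ext τ z; simp [jacobiSlash]
    · intro n r h; simp at h
    · intro τ z
      simp [jacobiSlash]
  add_mem' := by
    rintro φ ψ ⟨a1, a2, a3, a4⟩ ⟨b1, b2, b3, b4⟩
    refine ⟨a1.add b1, fun γ => ?_, fun l u τ z => ?_, fun g => ?_⟩
    · rw [jacobiSlash_add, a2, b2, smul_add]
    · simp only [Pi.add_apply, a3, b3, mul_add]
    · rw [jacobiSlash_add]; exact (a4 g).add (b4 g)
  smul_mem' := by
    rintro a φ ⟨a1, a2, a3, a4⟩
    refine ⟨a1.const_smul a, fun γ => ?_, fun l u τ z => ?_, fun g => ?_⟩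
    · rw [jacobiSlash_smul, a2, smul_comm]
    · simp only [Pi.smul_apply, a3, smul_eq_mul]; ring
    · rw [jacobiSlash_smul]; exact (a4 g).smul a

/-- The restriction map `D₀ : φ ↦ φ(τ, 0)`. -/
def restrictionMap : (ℍ → ℂ → ℂ) →ₗ[ℂ] (ℍ → ℂ) where
  toFun φ τ := φ τ 0
  map_add' _ _ := rfl
  map_smul' _ _ := rfl

/-- `J_{k,m}(Γ₀(M), ν)^0`, the kernel of the restriction map on `J_{k,m}(Γ₀(M), ν)`. -/
def jacobiKernel (k : ℤ) (m M : ℕ) (ν : Gamma0 M →* ℂ) : Submodule ℂ (ℍ → ℂ → ℂ) :=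
  jacobiForms k m M ν ⊓ LinearMap.ker restrictionMap

/-- `(h_r)_{0 ≤ r < 2m}` are the coefficients of the theta decomposition
`φ(τ, z) = ∑_{r=0}^{2m-1} h_r(τ) θ^J_{m,r}(τ, z)`. They are determined by `φ`. -/
def IsThetaDecomposition (m : ℕ) (φ : ℍ → ℂ → ℂ) (h : ℕ → ℍ → ℂ) : Prop :=
  ∀ (τ : ℍ) (z : ℂ), φ τ z = ∑ r ∈ Finset.range (2 * m), h r τ * theta m r τ z

/-- `J*_{k,m}(Γ₀(M), ν)`: the Jacobi forms whose theta decomposition has `h_r = 0` for all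
`r ≠ 0, m`. -/
def jacobiStar (k : ℤ) (m M : ℕ) (ν : Gamma0 M →* ℂ) : Submodule ℂ (ℍ → ℂ → ℂ) where
  carrier := {φ | φ ∈ jacobiForms k m M ν ∧ ∃ h : ℕ → ℍ → ℂ, IsThetaDecomposition m φ h ∧
    ∀ r < 2 * m, r ≠ 0 → r ≠ m → h r = 0}
  zero_mem' := ⟨zero_mem _, 0, fun τ z => by simp, fun _ _ _ _ => rfl⟩
  add_mem' := by
    rintro φ ψ ⟨a1, h, a2, a3⟩ ⟨b1, l, b2, b3⟩
    refine ⟨add_mem a1 b1, h + l, fun τ z => ?_, fun r h1 h2 h3 => ?_⟩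
    · simp only [Pi.add_apply, a2 τ z, b2 τ z, add_mul, Finset.sum_add_distrib]
    · rw [Pi.add_apply, a3 r h1 h2 h3, b3 r h1 h2 h3, add_zero]
  smul_mem' := by
    rintro a φ ⟨a1, h, a2, a3⟩
    refine ⟨Submodule.smul_mem _ a a1, a • h, fun τ z => ?_, fun r h1 h2 h3 => ?_⟩
    · simp only [Pi.smul_apply, smul_eq_mul, a2 τ z, Finset.mul_sum, mul_assoc]
    · rw [Pi.smul_apply, a3 r h1 h2 h3, smul_zero]

/-- `J*_{k,m}(Γ₀(M), ν)^0`, the kernel of the restriction map on `J*_{k,m}(Γ₀(M), ν)`. -/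
def jacobiStarKernel (k : ℤ) (m M : ℕ) (ν : Gamma0 M →* ℂ) : Submodule ℂ (ℍ → ℂ → ℂ) :=
  jacobiStar k m M ν ⊓ LinearMap.ker restrictionMap

/-! ## Modular forms with character -/

/-- The space `M_k(Γ₀(M), ν)` of modular forms of weight `k` and character `ν` for `Γ₀(M)`:
holomorphic functions `f` on `ℍ` with `f(γ τ) = ν(γ) (c τ + d)^k f(τ)` for `γ ∈ Γ₀(M)` which are
holomorphic at all cusps. -/
def modularForms (k : ℤ) (M : ℕ) (ν : Gamma0 M →* ℂ) : Submodule ℂ (ℍ → ℂ) where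
  carrier := {f | MDiff f ∧
    (∀ (γ : Gamma0 M) (τ : ℍ),
      f ((γ : SL(2, ℤ)) • τ) = ν γ * autFactor γ τ ^ k * f τ) ∧
    ∀ g : SL(2, ℤ), IsBoundedAtImInfty (f ∣[k] g)}
  zero_mem' := ⟨mdifferentiable_const, fun γ τ => by simp, fun g => by
    rw [SlashAction.zero_slash]; exact zero_form_isBoundedAtImInfty⟩
  add_mem' := by
    rintro f f' ⟨a1, a2, a3⟩ ⟨b1, b2, b3⟩
    refine ⟨a1.add b1, fun γ τ => ?_, fun g => ?_⟩
    · simp only [Pi.add_apply, a2, b2, mul_add]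
    · rw [SlashAction.add_slash]; exact (a3 g).add (b3 g)
  smul_mem' := by
    rintro a f ⟨a1, a2, a3⟩
    refine ⟨a1.const_smul a, fun γ τ => ?_, fun g => ?_⟩
    · simp only [Pi.smul_apply, a2, smul_eq_mul]; ring
    · rw [ModularForm.SL_smul_slash]; exact (a3 g).const_smul_left a

end

end JacobiRestriction

open JacobiRestriction

namespace JacobiRestriction

noncomputable section

/-! Everything rests on one function, `thetaDet m`. It is the determinant with columns (θ_{m,0},
θ_{m,m}) at z and at 0, so it vanishes at z = 0 and transforms under Γ₀(m) with weight 1, index m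
and character ω_m. Multiplication by it is an isomorphism from M_{k-1}(ν) onto the kernel of
restriction on J*_{k,m}(ν ω_m) (`map_mulThetaDet`). With ν = χ ω̄ this gives the second space of the
corollary. Taking index one instead gives the first: there every form has a theta decomposition with
r ∈ {0, 1}, so J* = J (`jacobiStar_one`), and ω̄ ω = 1.

Surjectivity is linear algebra at each τ. If φ = h_0 θ_{m,0} + h_m θ_{m,m} vanishes at z = 0, then
(h_0, h_m) is orthogonal to the vector of theta constants, hence a multiple f(τ) of (θ_{m,m}(τ,0),
-θ_{m,0}(τ,0)), and φ = f · `thetaDet m` (`exists_mulThetaDet_eq`). This needs the theta constants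
not to vanish together; in fact `thetaDet m` is nonzero for some z above every τ
(`exists_thetaDet_ne_zero`), which also lets f inherit holomorphy and its transformation law by
division.

At the cusps, writing (m, 0; 0, 1) g = g' (a, b; 0, d) shows that g turns `thetaDet m` into a
nonzero multiple of `thetaDet 1` at ((aτ+b)/d, az), with ad = m. If f|g has a q-expansion,
multiplying the series gives a Jacobi expansion (`hasJacobiExpansion_mul_thetaDet`). Conversely, the
coefficient of e(az) in the product is f|g times an explicit function of exact decay, and the Jacobi
condition on exponents makes f|g bounded (`isBoundedAtImInfty_of_hasJacobiExpansion`). -/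

/-- The point `(a τ + b) / d` of the upper half-plane, for positive `a` and `d`. -/
def affineMap (a d : ℕ) (b : ℤ) (τ : ℍ) : ℍ := ofComplex ((a * τ + b) / d)

lemma coe_affineMap {a d : ℕ} (ha : 0 < a) (hd : 0 < d) (b : ℤ) (τ : ℍ) :
    (affineMap a d b τ : ℂ) = (a * τ + b) / d := by
  have h : 0 < (((a : ℂ) * τ + b) / d).im := by
    rw [Complex.div_natCast_im]
    have := τ.im_pos
    simp only [Complex.add_im, Complex.mul_im, Complex.natCast_re, Complex.natCast_im,
      Complex.intCast_im, coe_im, zero_mul, add_zero]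
    positivity
  rw [affineMap, ofComplex_apply_of_im_pos h]

/-- `θ_{m,m}(τ,0) θ_{m,0}(τ,z) - θ_{m,0}(τ,0) θ_{m,m}(τ,z)`. -/
def thetaDet (m : ℕ) (τ : ℍ) (z : ℂ) : ℂ :=
  theta m m τ 0 * theta m 0 τ z - theta m 0 τ 0 * theta m m τ z

/-! ### The theta determinant: reduction to index one and transformation laws -/

lemma theta_zero_scale {m : ℕ} (hm : 0 < m) (τ : ℍ) (z : ℂ) :
    theta m 0 τ z = theta 1 0 (affineMap m 1 0 τ) (m * z) := by
  unfold theta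
  rw [coe_affineMap hm one_pos]
  refine tsum_congr fun n => ?_
  congr 1
  push_cast
  ring

lemma theta_self_scale {m : ℕ} (hm : 0 < m) (τ : ℍ) (z : ℂ) :
    theta m m τ z = theta 1 1 (affineMap m 1 0 τ) (m * z) := by
  unfold theta
  rw [coe_affineMap hm one_pos]
  refine tsum_congr fun n => ?_
  have : (m : ℂ) ≠ 0 := by exact_mod_cast hm.ne'
  congr 1
  push_cast
  field_simp
  ring

/-- For r = 0 and r = m the shift r/2m is 0 or 1/2, exactly as in index one. This is why r = 0, m
are singled out, and it reduces questions about index m to index one at (mτ, mz). -/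
lemma thetaDet_scale {m : ℕ} (hm : 0 < m) (τ : ℍ) (z : ℂ) :
    thetaDet m τ z = thetaDet 1 (affineMap m 1 0 τ) (m * z) := by
  unfold thetaDet
  simp only [theta_zero_scale hm, theta_self_scale hm, mul_zero]

lemma theta_elliptic {m : ℕ} (hm : 0 < m) (r : ℕ) (l u : ℤ) (τ : ℍ) (z : ℂ) :
    theta m r τ (z + l * τ + u) =
      Complex.exp (-(2 * π * Complex.I * m * ((l : ℂ) ^ 2 * τ + 2 * l * z))) * theta m r τ z := by
  have hm' : (m : ℂ) ≠ 0 := by exact_mod_cast hm.ne'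
  unfold theta
  rw [← tsum_mul_left, ← (Equiv.addRight l).tsum_eq (fun n : ℤ =>
    Complex.exp (-(2 * π * Complex.I * m * ((l : ℂ) ^ 2 * τ + 2 * l * z))) * Complex.exp _)]
  refine tsum_congr fun n => ?_
  -- After the shift n ↦ n + l completes the square, this is the factor left over from u.
  have hper : Complex.exp (2 * π * Complex.I * ((2 * m * n + r) * u : ℤ)) = 1 := by
    rw [Complex.exp_eq_one_iff]; exact ⟨_, by ring⟩
  rw [← Complex.exp_add, Equiv.coe_addRight, ← mul_one (Complex.exp (_ + _)), ← hper,
    ← Complex.exp_add]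
  congr 1
  push_cast
  field_simp
  ring

lemma thetaDet_elliptic {m : ℕ} (hm : 0 < m) (l u : ℤ) (τ : ℍ) (z : ℂ) :
    thetaDet m τ (z + l * τ + u) =
      Complex.exp (-(2 * π * Complex.I * m * ((l : ℂ) ^ 2 * τ + 2 * l * z))) *
        thetaDet m τ z := by
  unfold thetaDet
  rw [theta_elliptic hm, theta_elliptic hm]
  ring

lemma thetaDet_zero (m : ℕ) (τ : ℍ) : thetaDet m τ 0 = 0 := by
  unfold thetaDet; ring

/-- Both columns of the determinant, at z and at 0, are multiplied by the same U₁(γ), which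
contributes det U₁(γ). The two square roots multiply to cτ + d, so the weight is 1 and no choice of
branch remains. -/
lemma thetaDet_one_smul (γ : SL(2, ℤ)) (τ : ℍ) (z : ℂ) :
    thetaDet 1 (γ • τ) (z / autFactor γ τ) =
      Complex.exp (2 * π * Complex.I * ((γ 1 0 : ℂ) * z ^ 2 / autFactor γ τ)) * autFactor γ τ *
        detThetaMultiplier γ * thetaDet 1 τ z := by
  have h := thetaMultiplier_spec γ τ z
  have h' := thetaMultiplier_spec γ τ 0
  rw [zero_div] at h'
  have a := congrFun h 0
  have b := congrFun h 1
  have a' := congrFun h' 0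
  have b' := congrFun h' 1
  simp only [thetaVec, Matrix.mulVec, dotProduct, Fin.sum_univ_two, Matrix.cons_val_zero,
    Matrix.cons_val_one, Pi.smul_apply, smul_eq_mul] at a b a' b'
  have hs := sqrt_sq (autFactor γ τ)
  have hd : detThetaMultiplier γ = (thetaMultiplier γ).det := rfl
  unfold thetaDet
  rw [a, b, a', b', hd, Matrix.det_fin_two]
  simp only [ne_eq, OfNat.ofNat_ne_zero, not_false_eq_true, zero_pow, mul_zero, zero_div,
    Complex.exp_zero]
  generalize Complex.exp _ = e
  linear_combination e * (thetaMultiplier γ 0 0 * thetaMultiplier γ 1 1 -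
    thetaMultiplier γ 0 1 * thetaMultiplier γ 1 0) *
    (theta 1 1 τ 0 * theta 1 0 τ z - theta 1 0 τ 0 * theta 1 1 τ z) * hs

/-! ### Nonvanishing of the theta determinant -/

/-- With x = exp(-2π Im τ) ≤ e⁻³ ≤ 1/16, the theta constant differs from 1 by at most 2x/(1-x) ≤
2/15. The height 1/2 covers the fundamental domain, and the uniform lower bound is reused at the
cusps. -/
lemma half_lt_norm_theta_zero {τ : ℍ} (hτ : 1 / 2 ≤ τ.im) : 1 / 2 < ‖theta 1 0 τ 0‖ := by
  have h0 : 0 < (2 * (τ : ℂ)).im := by simpa using τ.im_pos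
  have h := norm_jacobiTheta_sub_one_le h0
  rw [theta_zero_eq, mul_zero, ← jacobiTheta_eq_jacobiTheta₂]
  have him : (2 * (τ : ℂ)).im = 2 * τ.im := by simp
  rw [him] at h
  have he : Real.exp (-π * (2 * τ.im)) ≤ 1 / 16 := by
    have h1 : Real.exp (-π * (2 * τ.im)) ≤ Real.exp (-3) := by
      apply Real.exp_le_exp.mpr
      nlinarith [Real.pi_gt_three]
    have h2 : Real.exp (-3) = Real.exp (-1) ^ 3 := by
      rw [← Real.exp_nat_mul]; norm_num
    have h3 : Real.exp (-1) ≤ 0.37 := by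
      have := Real.exp_neg_one_lt_d9
      linarith
    have h4 : Real.exp (-1) ^ 3 ≤ 0.37 ^ 3 := pow_le_pow_left₀ (Real.exp_pos _).le h3 3
    rw [h2] at h1
    norm_num at h4
    linarith
  have hpos := Real.exp_pos (-π * (2 * τ.im))
  set x := Real.exp (-π * (2 * τ.im))
  have hb : 2 / (1 - x) * x ≤ 2 / 15 := by
    rw [div_mul_eq_mul_div, div_le_iff₀ (by linarith)]
    linarith
  have := norm_sub_norm_le (1 : ℂ) (1 - jacobiTheta (2 * τ))
  rw [sub_sub_cancel, norm_one, norm_sub_rev] at this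
  linarith

/-- By the transformation law τ may be moved to the fundamental domain, where θ_{1,0}(τ,0) ≠ 0. If
the determinant vanished for all z, comparing z with z + 1/2, which changes the sign of θ_{1,1}
only, would give θ_{1,0}(τ,0) θ_{1,1}(τ,z) = 0. But at z = -τ/2 the second factor is an exponential
times θ_{1,0}(τ,0). -/
lemma exists_thetaDet_one_ne_zero (τ : ℍ) : ∃ z, thetaDet 1 τ z ≠ 0 := by
  obtain ⟨γ, hγ⟩ := ModularGroup.exists_smul_mem_fd τ
  have him : 1 / 2 ≤ (γ • τ).im := by
    have := ModularGroup.three_le_four_mul_im_sq_of_mem_fd hγ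
    have := (γ • τ).im_pos
    nlinarith
  have h0 := half_lt_norm_theta_zero him
  have h0' : theta 1 0 (γ • τ) 0 ≠ 0 := norm_pos_iff.mp (by linarith)
  by_contra! hz
  have hE : ∀ z, thetaDet 1 (γ • τ) z = 0 := fun z => by
    have := thetaDet_one_smul γ τ (z * autFactor γ τ)
    rwa [hz, mul_zero, mul_div_cancel_right₀ _ (autFactor_ne_zero γ τ)] at this
  have hne : theta 1 1 (γ • τ) (-((γ • τ : ℍ) : ℂ) / 2) ≠ 0 := by
    rw [theta_one_eq, show 2 * (-((γ • τ : ℍ) : ℂ) / 2) + ((γ • τ : ℍ) : ℂ) = 2 * 0 by ring,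
      ← theta_zero_eq]
    exact mul_ne_zero (Complex.exp_ne_zero _) h0'
  have a := hE (-((γ • τ : ℍ) : ℂ) / 2)
  have b := hE (-((γ • τ : ℍ) : ℂ) / 2 + 1 / 2)
  unfold thetaDet at a b
  rw [(theta_add' _ _).1, (theta_add' _ _).2] at b
  refine mul_ne_zero h0' hne ?_
  linear_combination (b - a) / 2

lemma exists_thetaDet_ne_zero {m : ℕ} (hm : 0 < m) (τ : ℍ) : ∃ z, thetaDet m τ z ≠ 0 := by
  obtain ⟨z, hz⟩ := exists_thetaDet_one_ne_zero (affineMap m 1 0 τ)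
  refine ⟨z / m, ?_⟩
  have : (m : ℂ) ≠ 0 := by exact_mod_cast hm.ne'
  rwa [thetaDet_scale hm, mul_div_cancel₀ _ this]

/-! ### The theta determinant under the full modular group -/

/-- If `(m, 0; 0, 1) g = g' (a, b; 0, d)`, then the weight one index `m` action of `g` turns
`thetaDet m` into a multiple of `thetaDet 1 ((a τ + b) / d, a z)`. -/
lemma jacobiSlash_thetaDet {m a d : ℕ} {b : ℤ} {g g' : SL(2, ℤ)} (hm : 0 < m) (ha : 0 < a)
    (hd : 0 < d) (h00 : g' 0 0 * a = m * g 0 0) (h10 : g' 1 0 * a = g 1 0)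
    (h01 : g' 0 0 * b + g' 0 1 * d = m * g 0 1) (h11 : g' 1 0 * b + g' 1 1 * d = g 1 1)
    (τ : ℍ) (z : ℂ) :
    jacobiSlash 1 m g (thetaDet m) τ z =
      detThetaMultiplier g' / d * thetaDet 1 (affineMap a d b τ) (a * z) := by
  have hd' : (d : ℂ) ≠ 0 := by exact_mod_cast hd.ne'
  have ha' : (a : ℂ) ≠ 0 := by exact_mod_cast ha.ne'
  have hj := autFactor_ne_zero g τ
  have hj' := autFactor_ne_zero g' (affineMap a d b τ)
  have c00 : (g' 0 0 : ℂ) * a = m * g 0 0 := by exact_mod_cast h00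
  have c10 : (g' 1 0 : ℂ) * a = g 1 0 := by exact_mod_cast h10
  have c01 : (g' 0 0 : ℂ) * b + g' 0 1 * d = m * g 0 1 := by exact_mod_cast h01
  have c11 : (g' 1 0 : ℂ) * b + g' 1 1 * d = g 1 1 := by exact_mod_cast h11
  have hjj : autFactor g τ = d * autFactor g' (affineMap a d b τ) := by
    unfold autFactor
    rw [coe_affineMap ha hd, ← c10, ← c11]
    field_simp
    ring
  -- Determinants of the two sides of the matrix identity.
  have hadm : (a : ℂ) * d = m := by
    have h1 := Matrix.det_fin_two g.1
    have h2 := Matrix.det_fin_two g'.1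
    rw [g.2] at h1
    rw [g'.2] at h2
    have c1 : (1 : ℂ) = g 0 0 * g 1 1 - g 0 1 * g 1 0 := by exact_mod_cast h1
    have c2 : (1 : ℂ) = g' 0 0 * g' 1 1 - g' 0 1 * g' 1 0 := by exact_mod_cast h2
    linear_combination a * d * c2 - m * c1 + (g' 1 0 * b + g' 1 1 * d) * c00 + m * g 0 0 * c11
      - g' 1 0 * a * c01 - m * g 0 1 * c10
  have hsm : affineMap m 1 0 (g • τ) = g' • affineMap a d b τ := by
    ext
    have e1 := coe_smul_mul_autFactor g τ
    have e2 := coe_smul_mul_autFactor g' (affineMap a d b τ)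
    rw [coe_affineMap hm one_pos]
    apply mul_right_cancel₀ hj
    rw [coe_affineMap ha hd] at e2
    push_cast
    rw [add_zero, div_one, mul_assoc, e1, hjj, mul_left_comm, e2]
    field_simp
    linear_combination -τ * c00 - c01
  have hz : (m : ℂ) * (z / autFactor g τ) = a * z / autFactor g' (affineMap a d b τ) := by
    rw [hjj, ← hadm]
    field_simp
  rw [jacobiSlash, thetaDet_scale hm, hsm, hz, thetaDet_one_smul]
  have he : Complex.exp (-(2 * π * Complex.I * m * ((g 1 0 : ℂ) * z ^ 2 / autFactor g τ))) *
      Complex.exp (2 * π * Complex.I *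
        ((g' 1 0 : ℂ) * (a * z) ^ 2 / autFactor g' (affineMap a d b τ))) = 1 := by
    rw [← Complex.exp_add, Complex.exp_eq_one_iff]
    refine ⟨0, ?_⟩
    rw [hjj, ← hadm, ← c10]
    field_simp
    ring
  rw [zpow_neg_one]
  revert he
  generalize Complex.exp _ = x
  generalize Complex.exp _ = y
  intro he
  rw [hjj]
  field_simp
  linear_combination detThetaMultiplier g' * thetaDet 1 (affineMap a d b τ) (a * z) * he

/-- Here a is the gcd of the first column of (m, 0; 0, 1) g; it divides the determinant m. A Bézout
relation completes the primitive column (p, r) to g' in SL(2, ℤ). -/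
lemma exists_hermite_decomposition {m : ℕ} (hm : 0 < m) (g : SL(2, ℤ)) :
    ∃ (a d : ℕ) (b : ℤ) (g' : SL(2, ℤ)), 0 < a ∧ 0 < d ∧ a * d = m ∧ g' 0 0 * a = m * g 0 0 ∧
      g' 1 0 * a = g 1 0 ∧ g' 0 0 * b + g' 0 1 * d = m * g 0 1 ∧
      g' 1 0 * b + g' 1 1 * d = g 1 1 := by
  have hdet := Matrix.det_fin_two g.1
  rw [g.2] at hdet
  have hgcd := Int.gcd_eq_gcd_ab (m * g 0 0) (g 1 0)
  obtain ⟨p, hp⟩ := Int.gcd_dvd_left (m * g 0 0) (g 1 0)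
  obtain ⟨r, hr⟩ := Int.gcd_dvd_right (m * g 0 0) (g 1 0)
  set a := Int.gcd (m * g 0 0) (g 1 0) with ha_def
  set x := Int.gcdA (m * g 0 0) (g 1 0)
  set y := Int.gcdB (m * g 0 0) (g 1 0)
  have ha0 : (a : ℤ) * (p * g 1 1 - r * m * g 0 1) = m := by
    linear_combination (-g 1 1) * hp + m * g 0 1 * hr - m * hdet
  have ham : a ∣ m := by exact_mod_cast Dvd.intro _ ha0
  obtain ⟨d, hd⟩ := ham
  have ha : 0 < a := Nat.pos_of_ne_zero fun h => by simp [h] at hd; omega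
  have hdp : 0 < d := Nat.pos_of_ne_zero fun h => by simp [h] at hd; omega
  have ha' : (a : ℤ) ≠ 0 := by exact_mod_cast ha.ne'
  have hd' : (m : ℤ) = a * d := by exact_mod_cast hd
  have hb : p * x + r * y = 1 := by
    apply mul_left_cancel₀ ha'
    linear_combination -x * hp - y * hr - hgcd
  have hdd : p * g 1 1 - r * m * g 0 1 = d := by
    apply mul_left_cancel₀ ha'
    linear_combination ha0 + hd'
  -- The inverse of g' is (x, y; -r, p); applied to the second column of (m, 0; 0, 1) g it gives (b,
  -- d).
  refine ⟨a, d, x * m * g 0 1 + y * g 1 1, ⟨!![p, -y; r, x], by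
    rw [Matrix.det_fin_two_of]; linear_combination hb⟩, ha, hdp, hd.symm, ?_, ?_, ?_, ?_⟩
  · change p * a = _
    linear_combination -hp
  · change r * a = _
    linear_combination -hr
  · change p * _ + -y * d = _
    linear_combination m * g 0 1 * hb + y * hdd
  · change r * _ + x * d = _
    linear_combination g 1 1 * hb - x * hdd

/-- For γ in Γ₀(m) the decomposition is (m, 0; 0, 1) γ = γ_m (m, 0; 0, 1), that is a = m, b = 0, d =
1, which is where ω_m comes from. -/
lemma jacobiSlash_thetaDet_Gamma0 {m : ℕ} (hm : 0 < m) (γ : Gamma0 m) (τ : ℍ) (z : ℂ) :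
    jacobiSlash 1 m γ (thetaDet m) τ z = omega m γ * thetaDet m τ z := by
  have h := Int.mul_ediv_cancel' (dvd_of_mem_Gamma0 γ)
  rw [jacobiSlash_thetaDet (g' := conjGamma0 m γ) (b := 0) hm hm one_pos, thetaDet_scale hm]
  · simp [omega]
  · simp [conjGamma0, mul_comm]
  · simpa [conjGamma0, mul_comm] using h
  · simp [conjGamma0, mul_comm]
  · simp [conjGamma0]

/-! ### Fourier expansions -/

/-- Products of series come indexed by more than the exponents; terms with equal exponents (N, R)
are collected. -/
lemma HasJacobiExpansion.of_hasSum {ι : Type*} {m h : ℕ} {φ : ℍ → ℂ → ℂ} (c : ι → ℂ)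
    (N R : ι → ℤ) (hh : 0 < h) (hc : ∀ i, c i ≠ 0 → (h : ℤ) * R i ^ 2 ≤ 4 * m * N i)
    (hs : ∀ (τ : ℍ) (z : ℂ), HasSum (fun i =>
      c i * Complex.exp (2 * π * Complex.I * ((N i : ℂ) / h * τ + R i * z))) (φ τ z)) :
    HasJacobiExpansion m φ := by
  refine ⟨h, fun p => ∑' i : (fun i => (N i, R i)) ⁻¹' {p}, c i, hh, fun n r hn => ?_,
    fun τ z => ?_⟩
  · by_contra hlt
    refine hn ?_
    refine (tsum_congr fun i => ?_).trans tsum_zero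
    by_contra h0
    have hi : N i.1 = n ∧ R i.1 = r := Prod.mk.inj i.2
    have := hc _ h0
    rw [hi.1, hi.2] at this
    exact hlt this
  · refine ((hs τ z).tsum_fiberwise fun i => (N i, R i)).congr_fun fun p => ?_
    rw [← tsum_mul_right]
    refine tsum_congr fun i => ?_
    have hi : (N i.1, R i.1) = p := i.2
    have h1 : N i.1 = p.1 := congrArg Prod.fst hi
    have h2 : R i.1 = p.2 := congrArg Prod.snd hi
    rw [h1, h2]

lemma integral_exp_two_pi_int (n : ℤ) :
    ∫ x in (0 : ℝ)..1, Complex.exp (2 * π * Complex.I * (n * x)) = if n = 0 then 1 else 0 := by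
  split_ifs with h
  · simp [h]
  · have hc : 2 * π * Complex.I * n ≠ 0 :=
      mul_ne_zero Complex.two_pi_I_ne_zero (by exact_mod_cast h)
    have := integral_exp_mul_complex (a := 0) (b := 1) hc
    simp only [← mul_assoc]
    rw [this]
    have h1 : Complex.exp (2 * π * Complex.I * n * (1 : ℝ)) = 1 := by
      rw [Complex.exp_eq_one_iff]
      exact ⟨n, by push_cast; ring⟩
    rw [h1]
    simp

/-- The `s`-th Fourier coefficient of a function on the real line. -/
def fourierInt (f : ℂ → ℂ) (s : ℤ) : ℂ :=
  ∫ x in (0 : ℝ)..1, f x * Complex.exp (2 * π * Complex.I * (-s * x))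

lemma norm_exp_two_pi_real (n : ℤ) (x : ℝ) :
    ‖Complex.exp (2 * π * Complex.I * (n * x))‖ = 1 := by
  have : 2 * π * Complex.I * (n * x) = ((2 * π * (n * x) : ℝ) : ℂ) * Complex.I := by
    push_cast; ring
  rw [this, Complex.norm_exp_ofReal_mul_I]

/-- The exponentials have modulus 1 on the real line, so convergence at z = 0 already yields a
summable dominating series for termwise integration. Several indices may share a frequency. -/
lemma hasSum_fourierInt {ι : Type*} [Countable ι] {c : ι → ℂ} {R : ι → ℤ} {f : ℂ → ℂ}
    (hf : ∀ z : ℂ, HasSum (fun i => c i * Complex.exp (2 * π * Complex.I * (R i * z))) (f z))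
    (s : ℤ) : HasSum (fun i => if R i = s then c i else 0) (fourierInt f s) := by
  have hc : Summable fun i => ‖c i‖ := by
    have := (hf 0).summable.norm
    simpa using this
  have key := intervalIntegral.hasSum_integral_of_dominated_convergence
    (μ := MeasureTheory.volume) (a := 0) (b := 1)
    (F := fun i (x : ℝ) => c i * Complex.exp (2 * π * Complex.I * ((R i - s : ℤ) * x)))
    (f := fun x : ℝ => f x * Complex.exp (2 * π * Complex.I * (-s * x)))
    (fun i _ => ‖c i‖) (fun i => by
      refine Continuous.aestronglyMeasurable ?_
      fun_prop)
    (fun i => Filter.Eventually.of_forall fun x _ => by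
      rw [norm_mul, norm_exp_two_pi_real, mul_one])
    (Filter.Eventually.of_forall fun _ _ => hc)
    (by simp)
    (Filter.Eventually.of_forall fun x _ => by
      refine ((hf x).mul_right (Complex.exp (2 * π * Complex.I * (-s * x)))).congr_fun fun i => ?_
      rw [mul_assoc (c i), ← Complex.exp_add]
      congr 2
      push_cast
      ring)
  refine key.congr_fun fun i => ?_
  rw [intervalIntegral.integral_const_mul, integral_exp_two_pi_int]
  simp [sub_eq_zero]

lemma fourierInt_eq {a : ℤ → ℂ} {f : ℂ → ℂ}
    (hf : ∀ z : ℂ, HasSum (fun r : ℤ => a r * Complex.exp (2 * π * Complex.I * (r * z))) (f z))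
    (s : ℤ) : fourierInt f s = a s :=
  (hasSum_fourierInt hf s).unique (hasSum_ite_eq s (a s)|>.congr_fun fun r => by
    split_ifs with h <;> simp [h])

/-- Substituting p = 2n + r puts both index one theta functions over the same lattice: even p here,
odd p for θ_{1,1}. -/
lemma hasSum_theta_even (τ : ℍ) (z : ℂ) : HasSum (fun p : ℤ => (if Even p then (1 : ℂ) else 0) *
    Complex.exp (2 * π * Complex.I * ((p : ℂ) ^ 2 / 4 * τ + p * z))) (theta 1 0 τ z) := by
  have hi : Function.Injective fun n : ℤ => 2 * n := fun a b h => by simpa using h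
  rw [← hi.hasSum_iff]
  · refine (hasSum_theta_zero τ z).hasSum.congr_fun fun n => ?_
    simp only [Function.comp_apply, even_two_mul, if_true, one_mul]
    congr 1
    push_cast
    ring
  · intro p hp
    rw [if_neg, zero_mul]
    rintro ⟨n, rfl⟩
    exact hp ⟨n, by ring⟩

lemma hasSum_theta_odd (τ : ℍ) (z : ℂ) : HasSum (fun p : ℤ => (if Even p then (0 : ℂ) else 1) *
    Complex.exp (2 * π * Complex.I * ((p : ℂ) ^ 2 / 4 * τ + p * z))) (theta 1 1 τ z) := by
  have hi : Function.Injective fun n : ℤ => 2 * n + 1 := fun a b h => by simpa using h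
  rw [← hi.hasSum_iff]
  · refine (hasSum_theta_one τ z).hasSum.congr_fun fun n => ?_
    have : ¬ Even (2 * n + 1) := by simp
    simp only [Function.comp_apply, this, if_false, one_mul]
    congr 1
    push_cast
    ring
  · intro p hp
    rw [if_pos, zero_mul]
    by_contra h
    obtain ⟨n, rfl⟩ := Int.not_even_iff_odd.mp h
    exact hp ⟨n, rfl⟩

lemma hasSum_mul_prod {ι κ : Type*} {f : ι → ℂ} {g : κ → ℂ} {a b : ℂ} (hf : HasSum f a)
    (hg : HasSum g b) : HasSum (fun x : ι × κ => f x.1 * g x.2) (a * b) :=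
  hf.mul hg (summable_mul_of_summable_norm hf.summable.norm hg.summable.norm)

/-- The coefficients of the double series of `thetaDet 1`. -/
def thetaSign (p : ℤ × ℤ) : ℂ :=
  (if Even p.1 then 0 else 1) * (if Even p.2 then 1 else 0) -
    (if Even p.1 then 1 else 0) * (if Even p.2 then 0 else 1)

lemma hasSum_thetaDet_one (τ : ℍ) (z : ℂ) : HasSum (fun p : ℤ × ℤ => thetaSign p *
    Complex.exp (2 * π * Complex.I * (((p.1 : ℂ) ^ 2 + (p.2 : ℂ) ^ 2) / 4 * τ + p.2 * z)))
      (thetaDet 1 τ z) := by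
  have e0 := hasSum_theta_even τ 0
  have o0 := hasSum_theta_odd τ 0
  have e := hasSum_theta_even τ z
  have o := hasSum_theta_odd τ z
  have h := (hasSum_mul_prod o0 e).sub (hasSum_mul_prod e0 o)
  rw [thetaDet]
  refine Eq.mp (congrArg (fun f => HasSum f _) (funext fun p => ?_)) h
  have hexp : Complex.exp (2 * π * Complex.I *
      (((p.1 : ℂ) ^ 2 + (p.2 : ℂ) ^ 2) / 4 * τ + p.2 * z)) =
      Complex.exp (2 * π * Complex.I * ((p.1 : ℂ) ^ 2 / 4 * τ + p.1 * 0)) *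
      Complex.exp (2 * π * Complex.I * ((p.2 : ℂ) ^ 2 / 4 * τ + p.2 * z)) := by
    rw [← Complex.exp_add]
    congr 1
    ring
  rw [hexp, thetaSign]
  generalize Complex.exp _ = x
  generalize Complex.exp _ = y
  ring

/-! ### The theta decomposition in index one -/

/-- Quasi-periodicity under z ↦ z + τ relates a(r+2) to a(r) so that a(r) e(-r²τ/4) has period 2.
The even and the odd r thus leave one free constant each. -/
lemma exists_thetaDecomposition {φ : ℂ → ℂ} {a : ℤ → ℂ} (τ : ℍ)
    (hs : ∀ z, HasSum (fun r : ℤ => a r * Complex.exp (2 * π * Complex.I * (r * z))) (φ z))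
    (hφ : ∀ z, φ (z + τ) = Complex.exp (-(2 * π * Complex.I * (τ + 2 * z))) * φ z) :
    ∃ u v : ℂ, ∀ z, φ z = u * theta 1 0 τ z + v * theta 1 1 τ z := by
  have hrec : ∀ r : ℤ, a (r + 2) = Complex.exp (2 * π * Complex.I * ((r + 1) * τ)) * a r := by
    intro r
    have h1 : ∀ z, HasSum (fun r : ℤ => a (r + 2) * Complex.exp (-(2 * π * Complex.I * τ)) *
        Complex.exp (2 * π * Complex.I * (r * z))) (φ (z + τ)) := fun z => by
      have := (Equiv.addRight (2 : ℤ)).hasSum_iff.mpr (hs z)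
      rw [hφ z]
      refine (this.mul_left (Complex.exp (-(2 * π * Complex.I * (τ + 2 * z))))).congr_fun
        fun r => ?_
      simp only [Function.comp_apply, Equiv.coe_addRight]
      rw [mul_left_comm (Complex.exp _), ← Complex.exp_add, mul_assoc (a (r + 2)),
        ← Complex.exp_add]
      congr 2
      push_cast
      ring
    have h2 : ∀ z, HasSum (fun r : ℤ => a r * Complex.exp (2 * π * Complex.I * (r * τ)) *
        Complex.exp (2 * π * Complex.I * (r * z))) (φ (z + τ)) := fun z => by
      refine (hs (z + τ)).congr_fun fun r => ?_
      rw [mul_assoc, ← Complex.exp_add]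
      congr 2
      ring
    have h3 := (fourierInt_eq (f := fun z => φ (z + τ)) h1 r).symm.trans
      (fourierInt_eq (f := fun z => φ (z + τ)) h2 r)
    have h4 : Complex.exp (2 * π * Complex.I * ((r + 1) * τ)) =
        Complex.exp (2 * π * Complex.I * (r * τ)) * Complex.exp (2 * π * Complex.I * τ) := by
      rw [← Complex.exp_add]
      congr 1
      ring
    have h5 : Complex.exp (-(2 * π * Complex.I * τ)) * Complex.exp (2 * π * Complex.I * τ) = 1 := by
      rw [← Complex.exp_add, neg_add_cancel, Complex.exp_zero]
    rw [h4]
    linear_combination (-a (r + 2)) * h5 + Complex.exp (2 * π * Complex.I * τ) * h3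
  set b : ℤ → ℂ := fun r => a r * Complex.exp (2 * π * Complex.I * (-(r : ℂ) ^ 2 / 4 * τ)) with hb
  have hb2 : Function.Periodic b 2 := fun r => by
    simp only [hb, hrec]
    rw [mul_comm _ (a r), mul_assoc, ← Complex.exp_add]
    congr 2
    push_cast
    ring
  have hab : ∀ r, a r = b r * Complex.exp (2 * π * Complex.I * ((r : ℂ) ^ 2 / 4 * τ)) := fun r => by
    simp only [hb]
    rw [mul_assoc, ← Complex.exp_add]
    have : 2 * π * Complex.I * (-(r : ℂ) ^ 2 / 4 * τ) +
      2 * π * Complex.I * ((r : ℂ) ^ 2 / 4 * τ) = 0 := by ring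
    rw [this, Complex.exp_zero, mul_one]
  refine ⟨b 0, b 1, fun z => (hs z).unique ?_⟩
  refine (((hasSum_theta_even τ z).mul_left (b 0)).add
    ((hasSum_theta_odd τ z).mul_left (b 1))).congr_fun fun r => ?_
  rw [hab, mul_add, Complex.exp_add]
  split_ifs with hr
  · obtain ⟨n, rfl⟩ := hr
    have : b (n + n) = b 0 := by
      have := hb2.int_mul n 0
      rw [← this]
      congr 1
      push_cast
      ring
    rw [this]
    ring
  · obtain ⟨n, rfl⟩ := Int.not_even_iff_odd.mp hr
    have : b (2 * n + 1) = b 1 := by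
      have := hb2.int_mul n 1
      rw [← this]
      congr 1
      push_cast
      ring
    rw [this]
    ring

lemma jacobiSlash_one (k : ℤ) (m : ℕ) (φ : ℍ → ℂ → ℂ) : jacobiSlash k m 1 φ = φ := by
  ext τ z
  simp [jacobiSlash, autFactor]

/-- For m = 1 no r remains besides 0 and m, so the content is that a theta decomposition exists. It
is obtained for each τ separately, summing the double expansion over n first. -/
lemma jacobiStar_one (k : ℤ) (M : ℕ) (ν : Gamma0 M →* ℂ) :
    jacobiStar k 1 M ν = jacobiForms k 1 M ν := by
  refine le_antisymm (fun φ h => h.1) fun φ h => ⟨h, ?_⟩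
  obtain ⟨-, -, h3, h4⟩ := h
  have h4 := h4 1
  rw [jacobiSlash_one] at h4
  obtain ⟨h, c, hh, -, hs⟩ := h4
  have key : ∀ τ : ℍ, ∃ u v : ℂ, ∀ z, φ τ z = u * theta 1 0 τ z + v * theta 1 1 τ z := by
    intro τ
    have hsm : ∀ z : ℂ, Summable fun p : ℤ × ℤ =>
        c p.swap * Complex.exp (2 * π * Complex.I * ((p.2 : ℂ) / h * τ + p.1 * z)) := fun z =>
      (Equiv.prodComm ℤ ℤ).summable_iff.mpr (hs τ z).summable
    refine exists_thetaDecomposition (a := fun r => ∑' n : ℤ,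
      c (n, r) * Complex.exp (2 * π * Complex.I * ((n : ℂ) / h * τ))) τ (fun z => ?_) fun z => ?_
    · have h1 : HasSum (fun p : ℤ × ℤ =>
          c p.swap * Complex.exp (2 * π * Complex.I * ((p.2 : ℂ) / h * τ + p.1 * z))) (φ τ z) :=
        (Equiv.prodComm ℤ ℤ).hasSum_iff.mpr (hs τ z)
      refine (h1.prod_fiberwise fun r => (h1.summable.prod_factor r).hasSum).congr_fun
        fun r => ?_
      rw [← tsum_mul_right]
      refine tsum_congr fun n => ?_
      rw [mul_assoc, ← Complex.exp_add, Prod.swap_prod_mk, mul_add]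
    · have := h3 1 0 τ z
      simpa using this
  choose u v huv using key
  -- Reduction mod 2 merely extends the pair to all of ℕ; only the values at 0 and 1 enter.
  refine ⟨![u, v] ∘ Fin.ofNat 2, fun τ z => ?_, fun r h1 h2 h3 => by omega⟩
  rw [huv, mul_one, Finset.sum_range_succ, Finset.sum_range_one]
  simp

/-! ### Behaviour at the cusps -/

lemma hasJacobiExpansion_mul_thetaDet {f : ℍ → ℂ} {α : ℕ → ℂ} {H a d : ℕ} (hH : 0 < H)
    (ha : 0 < a) (hd : 0 < d) (b : ℤ) (κ : ℂ)
    (hf : ∀ τ : ℍ, HasSum (fun n : ℕ => α n * Complex.exp (2 * π * Complex.I * ((n : ℂ) / H * τ)))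
      (f τ)) :
    HasJacobiExpansion (a * d)
      (fun τ z => f τ * (κ * thetaDet 1 (affineMap a d b τ) (a * z))) := by
  have hd' : (d : ℂ) ≠ 0 := by exact_mod_cast hd.ne'
  have hH' : (H : ℂ) ≠ 0 := by exact_mod_cast hH.ne'
  -- The exponent of τ is n/H + (p² + q²)a/(4d), with common denominator 4dH, and that of z is qa.
  -- The translation by b/d only contributes a phase to the coefficients.
  refine HasJacobiExpansion.of_hasSum (h := 4 * d * H) (fun i : ℕ × (ℤ × ℤ) => α i.1 *
      (κ * (thetaSign i.2 * Complex.exp (2 * π * Complex.I *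
        (((i.2.1 : ℂ) ^ 2 + (i.2.2 : ℂ) ^ 2) / 4 * (b / d))))))
    (fun i => 4 * d * i.1 + H * (i.2.1 ^ 2 + i.2.2 ^ 2) * a) (fun i => i.2.2 * a)
    (by positivity) (fun i _ => ?_) fun τ z => ?_
  -- This is 4(ad)N - hR²; it is nonnegative because f has no negative exponents.
  · have h : (0 : ℤ) ≤ 16 * a * d ^ 2 * i.1 + 4 * a ^ 2 * d * H * i.2.1 ^ 2 := by positivity
    push_cast
    linarith
  · refine (hasSum_mul_prod (hf τ)
      ((hasSum_thetaDet_one (affineMap a d b τ) (a * z)).mul_left κ)).congr_fun fun i => ?_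
    have hexp : Complex.exp (2 * π * Complex.I *
          (((i.2.1 : ℂ) ^ 2 + (i.2.2 : ℂ) ^ 2) / 4 * (b / d))) *
        Complex.exp (2 * π * Complex.I *
          (((4 * d * i.1 + H * (i.2.1 ^ 2 + i.2.2 ^ 2) * a : ℤ) : ℂ) / (4 * d * H : ℕ) * τ +
            (i.2.2 * a : ℤ) * z)) =
        Complex.exp (2 * π * Complex.I * ((i.1 : ℂ) / H * τ)) *
        Complex.exp (2 * π * Complex.I *
          (((i.2.1 : ℂ) ^ 2 + (i.2.2 : ℂ) ^ 2) / 4 * (affineMap a d b τ : ℂ) +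
            i.2.2 * (a * z))) := by
      rw [← Complex.exp_add, ← Complex.exp_add, coe_affineMap ha hd]
      congr 1
      push_cast
      field_simp
      ring
    linear_combination α i.1 * (κ * thetaSign i.2) * hexp

/-- Frequency a forces q = 1, which is odd, so only even p survive, with sign -1. They sum to
θ_{1,0}(τ,0), which is bounded away from zero high in the half-plane. -/
lemma fourierInt_thetaDet (τ : ℍ) {a : ℕ} (ha : 0 < a) (κ : ℂ) :
    fourierInt (fun z => κ * thetaDet 1 τ (a * z)) a =
      -(κ * (Complex.exp (2 * π * Complex.I * (τ / 4)) * theta 1 0 τ 0)) := by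
  have ha' : (a : ℤ) ≠ 0 := by exact_mod_cast ha.ne'
  have h1 : ∀ z, HasSum (fun p : ℤ × ℤ => κ * thetaSign p *
      Complex.exp (2 * π * Complex.I * (((p.1 : ℂ) ^ 2 + (p.2 : ℂ) ^ 2) / 4 * τ)) *
        Complex.exp (2 * π * Complex.I * ((p.2 * a : ℤ) * z))) (κ * thetaDet 1 τ (a * z)) :=
    fun z => by
      refine ((hasSum_thetaDet_one τ (a * z)).mul_left κ).congr_fun fun p => ?_
      rw [mul_assoc (κ * thetaSign p), ← Complex.exp_add, mul_assoc κ]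
      congr 3
      push_cast
      ring
  have h2 := hasSum_fourierInt (f := fun z => κ * thetaDet 1 τ (a * z)) h1 a
  refine h2.unique ?_
  have hi : Function.Injective fun p : ℤ => (p, (1 : ℤ)) := fun x y h => congrArg Prod.fst h
  rw [← hi.hasSum_iff]
  · have h3 := ((hasSum_theta_even τ 0).mul_left
      (-(κ * Complex.exp (2 * π * Complex.I * (τ / 4)))))
    rw [neg_mul, mul_assoc κ] at h3
    refine h3.congr_fun fun p => ?_
    have hs : thetaSign (p, 1) = -(if Even p then 1 else 0) := by
      simp [thetaSign]
    have he : Complex.exp (2 * π * Complex.I * (((p : ℂ) ^ 2 + ((1 : ℤ) : ℂ) ^ 2) / 4 * τ)) =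
        Complex.exp (2 * π * Complex.I * (τ / 4)) *
          Complex.exp (2 * π * Complex.I * ((p : ℂ) ^ 2 / 4 * τ + p * 0)) := by
      rw [← Complex.exp_add]
      congr 1
      push_cast
      ring
    simp only [Function.comp_apply, one_mul, if_true, hs, he]
    ring
  · rintro ⟨p, q⟩ hp
    refine if_neg fun h => hp ⟨p, ?_⟩
    have : q = 1 := mul_right_cancel₀ ha' (by simpa using h)
    rw [this]

lemma norm_exp_two_pi_I_mul (w : ℂ) :
    ‖Complex.exp (2 * π * Complex.I * w)‖ = Real.exp (-(2 * π * w.im)) := by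
  rw [Complex.norm_exp]
  congr 1
  simp

/-- Compare the coefficient of e(az) computed in two ways. From the expansion, r = a forces n/h ≥
a²/(4ad) = ρ, so it is O(exp(-2πρ Im τ)). From the product it is f times a factor of exactly this
order, so f is bounded. -/
lemma isBoundedAtImInfty_of_hasJacobiExpansion {f : ℍ → ℂ} {a d : ℕ} (ha : 0 < a) (hd : 0 < d)
    (b : ℤ) {κ : ℂ} (hκ : κ ≠ 0) (hφ : HasJacobiExpansion (a * d)
      (fun τ z => f τ * (κ * thetaDet 1 (affineMap a d b τ) (a * z)))) :
    IsBoundedAtImInfty f := by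
  obtain ⟨h, c, hh, hc, hs⟩ := hφ
  have hhR : (0 : ℝ) < h := by exact_mod_cast hh
  have haR : (0 : ℝ) < a := by exact_mod_cast ha
  have hdR : (0 : ℝ) < d := by exact_mod_cast hd
  set ρ : ℝ := a / (4 * d) with hρ
  have hcoef : ∀ τ : ℍ, HasSum (fun p : ℤ × ℤ => if p.2 = a then
      c p * Complex.exp (2 * π * Complex.I * ((p.1 : ℂ) / h * τ)) else 0)
      (-(f τ * κ * (Complex.exp (2 * π * Complex.I * ((affineMap a d b τ : ℂ) / 4)) *
        theta 1 0 (affineMap a d b τ) 0))) := fun τ => by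
    rw [← fourierInt_thetaDet _ ha]
    refine hasSum_fourierInt (R := Prod.snd) (fun z => ?_) a
    rw [mul_assoc (f τ)]
    refine (hs τ z).congr_fun fun p => ?_
    rw [mul_assoc (c p), ← Complex.exp_add, mul_add (2 * π * Complex.I)]
  -- The series at τ = i is the majorant: for Im τ ≥ 1 each term shrinks by at least exp(-2πρ(Im τ -
  -- 1)) relative to it.
  have hbase := (hcoef I).summable.norm.hasSum
  set B := ∑' p : ℤ × ℤ, ‖if p.2 = a then
      c p * Complex.exp (2 * π * Complex.I * ((p.1 : ℂ) / h * (I : ℍ))) else 0‖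
  rw [isBoundedAtImInfty_iff]
  -- The 2 inverts the lower bound 1/2 on the theta constant; Im τ ≥ d ensures both Im τ ≥ 1 and a
  -- Im τ / d ≥ 1/2.
  refine ⟨B * Real.exp (2 * π * ρ) * 2 / ‖κ‖, d, fun τ hτ => ?_⟩
  have hd1 : (1 : ℝ) ≤ d := by exact_mod_cast hd
  have hn : ∀ (n : ℤ) (σ : ℍ), ‖Complex.exp (2 * π * Complex.I * ((n : ℂ) / h * σ))‖ =
      Real.exp (-(2 * π * (n / h * σ.im))) := fun n σ => by
    rw [norm_exp_two_pi_I_mul]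
    congr 3
    rw [← Complex.ofReal_natCast, ← Complex.ofReal_intCast, ← Complex.ofReal_div,
      Complex.im_ofReal_mul, coe_im]
  have hle := (hcoef τ).norm_le_of_bounded
    (hbase.mul_right (Real.exp (2 * π * ρ) * Real.exp (-(2 * π * (ρ * τ.im))))) (fun p => by
      split_ifs with hp
      · rw [norm_mul, norm_mul, mul_assoc ‖c p‖, hn, hn, ← Real.exp_add, ← Real.exp_add]
        by_cases h0 : c p = 0
        · simp [h0]
        · have hr := hc p.1 p.2 h0
          rw [hp] at hr
          have hr' : (h : ℝ) * a ^ 2 ≤ 4 * (a * d) * p.1 := by exact_mod_cast hr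
          have hge : ρ ≤ p.1 / h := by
            rw [hρ, div_le_div_iff₀ (by positivity) hhR]
            nlinarith
          refine mul_le_mul_of_nonneg_left (Real.exp_le_exp.mpr ?_) (norm_nonneg _)
          have h1 : 0 ≤ (p.1 / h - ρ) * (τ.im - 1) :=
            mul_nonneg (by linarith) (by linarith)
          have h2 := mul_nonneg Real.two_pi_pos.le h1
          simp only [I_im]
          linarith
      · simp)
  have him : (affineMap a d b τ).im = a * τ.im / d := by
    rw [← coe_im, coe_affineMap ha hd, Complex.div_natCast_im]
    simp
  have hθ : 1 / 2 < ‖theta 1 0 (affineMap a d b τ) 0‖ := by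
    refine half_lt_norm_theta_zero ?_
    rw [him, le_div_iff₀ hdR]
    have : (1 : ℝ) ≤ a := by exact_mod_cast ha
    nlinarith
  have hq : ‖Complex.exp (2 * π * Complex.I * ((affineMap a d b τ : ℂ) / 4))‖ =
      Real.exp (-(2 * π * (ρ * τ.im))) := by
    rw [norm_exp_two_pi_I_mul]
    congr 3
    rw [Complex.div_ofNat_im, coe_im, him, hρ]
    field_simp
  rw [norm_neg, norm_mul, norm_mul, norm_mul, hq] at hle
  have hκ' : 0 < ‖κ‖ := norm_pos_iff.mpr hκ
  rw [le_div_iff₀ hκ']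
  have hE := Real.exp_pos (-(2 * π * (ρ * τ.im)))
  have h1 : ‖f τ‖ * ‖κ‖ * ‖theta 1 0 (affineMap a d b τ) 0‖ ≤ B * Real.exp (2 * π * ρ) := by
    refine le_of_mul_le_mul_right ?_ hE
    linarith
  have h2 : 0 ≤ ‖f τ‖ * ‖κ‖ := by positivity
  nlinarith

/-! ### Holomorphy -/

lemma differentiableOn_thetaDet {m : ℕ} (hm : 0 < m) :
    DifferentiableOn ℂ (fun p : ℂ × ℂ => thetaDet m (ofComplex p.1) p.2) {p | 0 < p.1.im} := by
  intro p hp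
  have hmR : (0 : ℝ) < m := by exact_mod_cast hm
  have hev : ∀ q ∈ {p : ℂ × ℂ | 0 < p.1.im}, thetaDet m (ofComplex q.1) q.2 =
      Complex.exp (π * Complex.I * (m * q.1) / 2) * jacobiTheta₂ (m * q.1) (2 * (m * q.1)) *
        jacobiTheta₂ (2 * (m * q.2)) (2 * (m * q.1)) -
      jacobiTheta₂ 0 (2 * (m * q.1)) *
        (Complex.exp (π * Complex.I * (m * q.1) / 2 + 2 * π * Complex.I * (m * q.2)) *
          jacobiTheta₂ (2 * (m * q.2) + m * q.1) (2 * (m * q.1))) := by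
    intro q hq
    rw [thetaDet_scale hm, thetaDet, theta_zero_eq, theta_zero_eq, theta_one_eq, theta_one_eq,
      coe_affineMap hm one_pos, ofComplex_apply_of_im_pos hq]
    simp
  refine DifferentiableWithinAt.congr ?_ hev (hev p hp)
  have him : 0 < (2 * (m * p.1)).im := by
    have : 0 < p.1.im := hp
    simp only [Complex.mul_im, Complex.natCast_re, Complex.natCast_im, Complex.re_ofNat,
      Complex.im_ofNat, zero_mul, add_zero]
    positivity
  have hθ : ∀ g : ℂ × ℂ → ℂ, DifferentiableAt ℂ g p →
      DifferentiableAt ℂ (fun q : ℂ × ℂ => jacobiTheta₂ (g q) (2 * (m * q.1))) p := by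
    intro g hg
    have h1 := (hasFDerivAt_jacobiTheta₂ (g p) him).differentiableAt
    exact DifferentiableAt.comp (g := fun q : ℂ × ℂ => jacobiTheta₂ q.1 q.2)
      (f := fun q : ℂ × ℂ => (g q, 2 * (m * q.1))) p h1 (hg.prodMk (by fun_prop))
  refine DifferentiableAt.differentiableWithinAt ?_
  have h1 := hθ (fun q => m * q.1) (by fun_prop)
  have h2 := hθ (fun q => 2 * (m * q.2)) (by fun_prop)
  have h3 := hθ (fun q => 0) (by fun_prop)
  have h4 := hθ (fun q => 2 * (m * q.2) + m * q.1) (by fun_prop)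
  exact (((by fun_prop : DifferentiableAt ℂ (fun q : ℂ × ℂ =>
    Complex.exp (π * Complex.I * (m * q.1) / 2)) p).mul h1).mul h2).sub
      (h3.mul ((by fun_prop : DifferentiableAt ℂ (fun q : ℂ × ℂ =>
        Complex.exp (π * Complex.I * (m * q.1) / 2 + 2 * π * Complex.I * (m * q.2))) p).mul h4))

/-- Near a given point one can fix z with `thetaDet m` nonzero and divide by it. -/
lemma mdifferentiable_of_mul_thetaDet {m : ℕ} (hm : 0 < m) {f : ℍ → ℂ}
    (h : DifferentiableOn ℂ (fun p : ℂ × ℂ => f (ofComplex p.1) * thetaDet m (ofComplex p.1) p.2)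
      {p | 0 < p.1.im}) : MDiff f := by
  rw [mdifferentiable_iff]
  intro w hw
  refine DifferentiableAt.differentiableWithinAt ?_
  have hopen : IsOpen {p : ℂ × ℂ | 0 < p.1.im} :=
    isOpen_lt continuous_const (Complex.continuous_im.comp continuous_fst)
  obtain ⟨z, hz⟩ := exists_thetaDet_ne_zero hm (ofComplex w)
  have hline : DifferentiableAt ℂ (fun w : ℂ => (w, z)) w := by fun_prop
  have h1 : DifferentiableAt ℂ (fun w => f (ofComplex w) * thetaDet m (ofComplex w) z) w :=
    DifferentiableAt.comp (f := fun w : ℂ => (w, z)) w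
      (h.differentiableAt (x := (w, z)) (hopen.mem_nhds hw)) hline
  have h2 : DifferentiableAt ℂ (fun w => thetaDet m (ofComplex w) z) w :=
    DifferentiableAt.comp (f := fun w : ℂ => (w, z)) w
      ((differentiableOn_thetaDet hm).differentiableAt (x := (w, z)) (hopen.mem_nhds hw)) hline
  refine (h1.div h2 hz).congr_of_eventuallyEq ?_
  filter_upwards [h2.continuousAt.eventually_ne hz] with v hv
  simp only [Pi.div_apply, Function.comp_apply]
  rw [mul_div_cancel_right₀ _ hv]

/-! ### Multiplication by `thetaDet` -/

lemma slash_eq_autFactor (k : ℤ) (f : ℍ → ℂ) (g : SL(2, ℤ)) (τ : ℍ) :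
    (f ∣[k] g) τ = autFactor g τ ^ (-k) * f (g • τ) := by
  rw [ModularForm.SL_slash_apply, mul_comm, autFactor_eq_denom]

lemma jacobiSlash_mul (k : ℤ) (m : ℕ) (g : SL(2, ℤ)) (f : ℍ → ℂ) (ψ : ℍ → ℂ → ℂ) (τ : ℍ) (z : ℂ) :
    jacobiSlash k m g (fun τ z => f τ * ψ τ z) τ z =
      (f ∣[k - 1] g) τ * jacobiSlash 1 m g ψ τ z := by
  rw [slash_eq_autFactor, jacobiSlash, jacobiSlash,
    show -k = -(k - 1) + -1 by ring, zpow_add₀ (autFactor_ne_zero g τ)]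
  ring

/-- Multiplication of a function on the upper half-plane by `thetaDet m`. -/
def mulThetaDet (m : ℕ) : (ℍ → ℂ) →ₗ[ℂ] (ℍ → ℂ → ℂ) where
  toFun f τ z := f τ * thetaDet m τ z
  map_add' f g := by ext τ z; simp [add_mul]
  map_smul' a f := by ext τ z; simp [mul_assoc]

lemma mulThetaDet_injective {m : ℕ} (hm : 0 < m) : Function.Injective (mulThetaDet m) := by
  intro f g h
  ext τ
  obtain ⟨z, hz⟩ := exists_thetaDet_ne_zero hm τ
  exact mul_right_cancel₀ hz (congrFun (congrFun h τ) z)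

lemma exists_jacobiSlash_mulThetaDet {m : ℕ} (hm : 0 < m) (g : SL(2, ℤ)) :
    ∃ (a d : ℕ) (b : ℤ) (κ : ℂ), 0 < a ∧ 0 < d ∧ a * d = m ∧ κ ≠ 0 ∧
      ∀ (k : ℤ) (f : ℍ → ℂ), jacobiSlash k m g (mulThetaDet m f) =
        fun τ z => (f ∣[k - 1] g) τ * (κ * thetaDet 1 (affineMap a d b τ) (a * z)) := by
  obtain ⟨a, d, b, g', ha, hd, had, h00, h10, h01, h11⟩ := exists_hermite_decomposition hm g
  refine ⟨a, d, b, detThetaMultiplier g' / d, ha, hd, had, ?_, fun k f => ?_⟩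
  · have : IsUnit (detThetaMultiplier g') := (Group.isUnit g').map detThetaMultiplier
    exact div_ne_zero this.ne_zero (by exact_mod_cast hd.ne')
  · ext τ z
    exact (jacobiSlash_mul k m g f (thetaDet m) τ z).trans
      (by rw [jacobiSlash_thetaDet hm ha hd h00 h10 h01 h11])

lemma slash_Gamma0 {k : ℤ} {M : ℕ} {ν : Gamma0 M →* ℂ} {f : ℍ → ℂ} (γ : Gamma0 M) :
    (∀ τ : ℍ, f ((γ : SL(2, ℤ)) • τ) = ν γ * autFactor γ τ ^ k * f τ) ↔
      f ∣[k] (γ : SL(2, ℤ)) = ν γ • f := by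
  rw [funext_iff]
  refine forall_congr' fun τ => ?_
  have := zpow_ne_zero k (autFactor_ne_zero γ τ)
  rw [slash_eq_autFactor, zpow_neg, inv_mul_eq_iff_eq_mul₀ this, Pi.smul_apply, smul_eq_mul]
  constructor <;> intro h <;> rw [h] <;> ring

/-- `ν` is trivial on the conjugates of the translation `τ ↦ τ + H` by elements of `SL(2, ℤ)`. -/
def TrivialOnTranslations {M : ℕ} (ν : Gamma0 M →* ℂ) (H : ℕ) : Prop :=
  ∀ g : SL(2, ℤ), ∃ γ : Gamma0 M, (γ : SL(2, ℤ)) = g * ModularGroup.T ^ H * g⁻¹ ∧ ν γ = 1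

/-- Triviality of ν on g T^H g⁻¹ makes f|g periodic with period H; boundedness at the cusp leaves
only exponents n ≥ 0. -/
lemma hasSum_slash {k : ℤ} {M H : ℕ} (hH : 0 < H) {ν : Gamma0 M →* ℂ}
    (hν : TrivialOnTranslations ν H) {f : ℍ → ℂ} (hf : f ∈ modularForms k M ν) (g : SL(2, ℤ)) :
    ∃ α : ℕ → ℂ, ∀ τ : ℍ, HasSum (fun n : ℕ =>
      α n * Complex.exp (2 * π * Complex.I * ((n : ℂ) / H * τ))) ((f ∣[k] g) τ) := by
  obtain ⟨h1, h2, h3⟩ := hf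
  obtain ⟨γ, hγ, hν⟩ := hν g
  have hslash : f ∣[k] (γ : SL(2, ℤ)) = f := by
    rw [(slash_Gamma0 γ).mp (h2 γ), hν, one_smul]
  have hT : (f ∣[k] g) ∣[k] (ModularGroup.T ^ H) = f ∣[k] g := by
    rw [← SlashAction.slash_mul, ← inv_mul_cancel_right (g * ModularGroup.T ^ H) g, ← hγ,
      SlashAction.slash_mul, hslash]
  have hper : ∀ τ : ℍ, (f ∣[k] g) (((H : ℝ)) +ᵥ τ) = (f ∣[k] g) τ := fun τ => by
    have := congrFun hT τ
    rw [slash_eq_autFactor] at this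
    have hj : autFactor (ModularGroup.T ^ H) τ = 1 := by
      have := ModularGroup.coe_T_zpow H
      rw [zpow_natCast] at this
      simp [autFactor, this]
    rw [hj, one_zpow, one_mul] at this
    rw [← this]
    refine congrArg _ (UpperHalfPlane.ext ?_)
    have := ModularGroup.coe_T_zpow_smul_eq (z := τ) (n := H)
    rw [zpow_natCast] at this
    rw [this, coe_vadd]
    push_cast
    ring
  have hper' : Function.Periodic ((f ∣[k] g) ∘ ofComplex) (H : ℝ) := by
    intro w
    by_cases hw : 0 < w.im
    · have hw' : 0 < (w + (H : ℝ)).im := by simpa using hw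
      simp only [Function.comp_apply]
      rw [ofComplex_apply_of_im_pos hw', ofComplex_apply_of_im_pos hw, ← hper ⟨w, hw⟩]
      refine congrArg _ (UpperHalfPlane.ext ?_)
      simp [add_comm]
    · have hw' : ¬ 0 < (w + (H : ℝ)).im := by simpa using hw
      simp only [Function.comp_apply]
      rw [ofComplex_apply_of_im_nonpos (not_lt.mp hw), ofComplex_apply_of_im_nonpos (not_lt.mp hw')]
  have hhol : MDiff (f ∣[k] g) := h1.slash k _
  have hHR : (0 : ℝ) < H := by exact_mod_cast hH
  refine ⟨fun n => (qExpansion H (f ∣[k] g)).coeff n, fun τ => ?_⟩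
  refine (hasSum_qExpansion hHR hper' hhol (h3 g) τ).congr_fun fun n => ?_
  rw [smul_eq_mul, Function.Periodic.qParam, ← Complex.exp_nat_mul]
  congr 2
  push_cast
  ring

lemma restrictChar_omega_mul_thetaDet {m M : ℕ} (hm : 0 < m) (h : m ∣ M) (γ : Gamma0 M) (τ : ℍ)
    (z : ℂ) : jacobiSlash 1 m γ (thetaDet m) τ z = restrictChar h (omega m) γ * thetaDet m τ z :=
  jacobiSlash_thetaDet_Gamma0 hm (Subgroup.inclusion (Gamma0_le_of_dvd h) γ) τ z

lemma mulThetaDet_Gamma0 {k : ℤ} {m M : ℕ} (hm : 0 < m) (h : m ∣ M) (ν : Gamma0 M →* ℂ)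
    (f : ℍ → ℂ) (γ : Gamma0 M) :
    jacobiSlash k m γ (mulThetaDet m f) = (ν * restrictChar h (omega m)) γ • mulThetaDet m f ↔
      f ∣[k - 1] (γ : SL(2, ℤ)) = ν γ • f := by
  have hω : restrictChar h (omega m) γ ≠ 0 :=
    ((Group.isUnit γ).map (restrictChar h (omega m))).ne_zero
  have key : jacobiSlash k m γ (mulThetaDet m f) = fun τ z =>
      restrictChar h (omega m) γ * ((f ∣[k - 1] (γ : SL(2, ℤ))) τ * thetaDet m τ z) := by
    ext τ z
    refine (jacobiSlash_mul k m γ f (thetaDet m) τ z).trans ?_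
    rw [restrictChar_omega_mul_thetaDet hm h]
    ring
  constructor
  · intro h1
    refine mulThetaDet_injective hm ?_
    ext τ z
    have h2 := congrFun (congrFun (key.symm.trans h1) τ) z
    refine mul_left_cancel₀ hω (h2.trans ?_)
    simp only [mulThetaDet, LinearMap.coe_mk, AddHom.coe_mk, MonoidHom.mul_apply, Pi.smul_apply,
      smul_eq_mul]
    ring
  · intro h1
    rw [key, h1]
    ext τ z
    simp only [mulThetaDet, LinearMap.coe_mk, AddHom.coe_mk, MonoidHom.mul_apply, Pi.smul_apply,
      smul_eq_mul]
    ring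

lemma mulThetaDet_mem {k : ℤ} {m M H : ℕ} (hm : 0 < m) (h : m ∣ M) (hH : 0 < H)
    {ν : Gamma0 M →* ℂ} (hν : TrivialOnTranslations ν H) {f : ℍ → ℂ}
    (hf : f ∈ modularForms (k - 1) M ν) :
    mulThetaDet m f ∈ jacobiStarKernel k m M (ν * restrictChar h (omega m)) := by
  refine ⟨⟨⟨?_, fun γ => ?_, fun l u τ z => ?_, fun g => ?_⟩, ?_⟩, ?_⟩
  · have h1 := UpperHalfPlane.mdifferentiable_iff.mp hf.1
    have h2 : DifferentiableOn ℂ (fun p : ℂ × ℂ => f (ofComplex p.1)) {p | 0 < p.1.im} :=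
      DifferentiableOn.comp (g := f ∘ ofComplex) h1 differentiableOn_fst fun p hp => hp
    exact h2.mul (differentiableOn_thetaDet hm)
  · exact (mulThetaDet_Gamma0 hm h ν f γ).mpr ((slash_Gamma0 γ).mp (hf.2.1 γ))
  · simp only [mulThetaDet, LinearMap.coe_mk, AddHom.coe_mk]
    rw [thetaDet_elliptic hm]
    ring
  · obtain ⟨a, d, b, κ, ha, hd, rfl, -, hs⟩ := exists_jacobiSlash_mulThetaDet hm g
    obtain ⟨α, hα⟩ := hasSum_slash hH hν hf g
    rw [hs]
    exact hasJacobiExpansion_mul_thetaDet hH ha hd b κ hα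
  · refine ⟨fun r τ => if r = 0 then f τ * theta m m τ 0 else
      if r = m then -(f τ * theta m 0 τ 0) else 0, fun τ z => ?_, fun r _ h0 h1 => ?_⟩
    · rw [Finset.sum_eq_add_of_mem 0 m (by simp; omega) (by simp; omega) hm.ne fun r _ hr => by
        simp [hr.1, hr.2]]
      simp only [mulThetaDet, LinearMap.coe_mk, AddHom.coe_mk, thetaDet, hm.ne', if_true, if_false]
      ring
    · ext τ; simp [h0, h1]
  · refine LinearMap.mem_ker.mpr ?_
    ext τ
    simp [restrictionMap, mulThetaDet, thetaDet_zero]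

/-- At each τ the relation h_0 θ_{m,0}(τ,0) + h_m θ_{m,m}(τ,0) = 0 has a one-dimensional solution
space. The factor f is found by dividing by whichever theta constant is nonzero, so no regularity of
f is claimed yet. -/
lemma exists_mulThetaDet_eq {m : ℕ} (hm : 0 < m) {φ : ℍ → ℂ → ℂ} {h : ℕ → ℍ → ℂ}
    (hφ : IsThetaDecomposition m φ h) (h0 : ∀ r < 2 * m, r ≠ 0 → r ≠ m → h r = 0)
    (hker : ∀ τ, φ τ 0 = 0) : ∃ f, mulThetaDet m f = φ := by
  have hsum : ∀ τ z, φ τ z = h 0 τ * theta m 0 τ z + h m τ * theta m m τ z := fun τ z => by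
    rw [hφ, Finset.sum_eq_add_of_mem 0 m (by simp; omega) (by simp; omega) hm.ne fun r hr hr' => by
      rw [h0 r (Finset.mem_range.mp hr) hr'.1 hr'.2]; simp]
  have key : ∀ τ, ∃ c, ∀ z, c * thetaDet m τ z = φ τ z := by
    intro τ
    have hz := hsum τ 0
    rw [hker] at hz
    by_cases h1 : theta m m τ 0 = 0
    · have h2 : theta m 0 τ 0 ≠ 0 := fun h2 => by
        obtain ⟨z, hne⟩ := exists_thetaDet_ne_zero hm τ
        exact hne (by rw [thetaDet, h1, h2]; ring)
      refine ⟨-h m τ / theta m 0 τ 0, fun z => ?_⟩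
      rw [h1, mul_zero, add_zero] at hz
      have h3 := (mul_eq_zero.mp hz.symm).resolve_right h2
      rw [hsum, h3, thetaDet, h1]
      field_simp
      ring
    · refine ⟨h 0 τ / theta m m τ 0, fun z => ?_⟩
      rw [hsum, thetaDet]
      field_simp
      linear_combination theta m m τ z * hz
  choose c hc using key
  exact ⟨c, funext fun τ => funext fun z => hc τ z⟩

lemma mem_modularForms_of_mulThetaDet_mem {k : ℤ} {m M : ℕ} (hm : 0 < m) (h : m ∣ M)
    {ν : Gamma0 M →* ℂ} {f : ℍ → ℂ}
    (hf : mulThetaDet m f ∈ jacobiForms k m M (ν * restrictChar h (omega m))) :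
    f ∈ modularForms (k - 1) M ν := by
  obtain ⟨h1, h2, -, h4⟩ := hf
  refine ⟨mdifferentiable_of_mul_thetaDet hm h1, fun γ => ?_, fun g => ?_⟩
  · exact (slash_Gamma0 γ).mpr ((mulThetaDet_Gamma0 hm h ν f γ).mp (h2 γ))
  · obtain ⟨a, d, b, κ, ha, hd, rfl, hκ, hs⟩ := exists_jacobiSlash_mulThetaDet hm g
    have := h4 g
    rw [hs] at this
    exact isBoundedAtImInfty_of_hasJacobiExpansion ha hd b hκ this

theorem map_mulThetaDet {k : ℤ} {m M H : ℕ} (hm : 0 < m) (h : m ∣ M) (hH : 0 < H)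
    {ν : Gamma0 M →* ℂ} (hν : TrivialOnTranslations ν H) :
    (modularForms (k - 1) M ν).map (mulThetaDet m) =
      jacobiStarKernel k m M (ν * restrictChar h (omega m)) := by
  ext φ
  constructor
  · rintro ⟨f, hf, rfl⟩
    exact mulThetaDet_mem hm h hH hν hf
  · rintro ⟨⟨hφ, l, hl, hl0⟩, hker⟩
    obtain ⟨f, rfl⟩ := exists_mulThetaDet_eq hm hl hl0 fun τ =>
      congrFun (LinearMap.mem_ker.mp hker) τ
    exact ⟨f, mem_modularForms_of_mulThetaDet_mem hm h hφ, rfl⟩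

/-- Multiplication by `thetaDet m` identifies modular forms of weight `k - 1` with the kernel of
the restriction map on `J*_{k,m}`. -/
def mulThetaDetEquiv {k : ℤ} {m M H : ℕ} (hm : 0 < m) (h : m ∣ M) (hH : 0 < H)
    {ν : Gamma0 M →* ℂ} (hν : TrivialOnTranslations ν H) :
    modularForms (k - 1) M ν ≃ₗ[ℂ] jacobiStarKernel k m M (ν * restrictChar h (omega m)) :=
  (Submodule.equivMapOfInjective (mulThetaDet m) (mulThetaDet_injective hm) _).trans
    (LinearEquiv.ofEq _ _ (map_mulThetaDet hm h hH hν))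

/-! ### The characters -/

/-- The relations S⁴ = 1 and (ST)³ = S² force every character of SL(2, ℤ) to have order dividing 12.
Hence conjugating ω inverts it, and ω is trivial on 12th powers. -/
lemma detThetaMultiplier_pow (γ : SL(2, ℤ)) : detThetaMultiplier γ ^ 12 = 1 := by
  have hS4 : ModularGroup.S ^ 4 = 1 := by decide
  have hST : (ModularGroup.S * ModularGroup.T) ^ 3 = ModularGroup.S ^ 2 := by decide
  set s := detThetaMultiplier ModularGroup.S with hs
  set t := detThetaMultiplier ModularGroup.T with ht
  have h1 : s ^ 4 = 1 := by rw [hs, ← map_pow, hS4, map_one]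
  have h2 : (s * t) ^ 3 = s ^ 2 := by rw [hs, ht, ← map_mul, ← map_pow, hST, map_pow]
  have hs12 : s ^ 12 = 1 := by linear_combination (s ^ 8 + s ^ 4 + 1) * h1
  have ht12 : t ^ 12 = 1 := by
    calc t ^ 12 = s ^ 12 * t ^ 12 := by rw [hs12, one_mul]
      _ = ((s * t) ^ 3) ^ 4 := by ring
      _ = (s ^ 4) ^ 2 := by rw [h2]; ring
      _ = 1 := by rw [h1, one_pow]
  have hγ : γ ∈ Subgroup.closure {ModularGroup.S, ModularGroup.T} := by
    rw [SpecialLinearGroup.SL2Z_generators]; trivial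
  induction hγ using Subgroup.closure_induction with
  | one => simp
  | mem x hx =>
    rcases hx with rfl | rfl
    · exact hs12
    · exact ht12
  | inv x _ hx =>
    have := map_mul detThetaMultiplier x x⁻¹
    rw [mul_inv_cancel, map_one] at this
    rw [← one_mul (detThetaMultiplier x⁻¹ ^ 12)]
    nth_rewrite 1 [← hx]
    rw [← mul_pow, ← this, one_pow]
  | mul x y _ _ hx hy => rw [map_mul, mul_pow, hx, hy, one_mul]

lemma conj_detThetaMultiplier_mul (γ : SL(2, ℤ)) :
    (starRingEnd ℂ) (detThetaMultiplier γ) * detThetaMultiplier γ = 1 := by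
  have h : ‖detThetaMultiplier γ‖ = 1 :=
    Complex.norm_eq_one_of_pow_eq_one (detThetaMultiplier_pow γ) (by norm_num)
  rw [mul_comm, Complex.mul_conj, Complex.normSq_eq_norm_sq, h]
  norm_num

lemma conjGamma0_one (γ : Gamma0 1) : conjGamma0 1 γ = γ := by
  ext i j
  fin_cases i <;> fin_cases j <;> simp [conjGamma0]

lemma restrictChar_omega_one {M : ℕ} (γ : Gamma0 M) :
    restrictChar (one_dvd M) (omega 1) γ = detThetaMultiplier γ := by
  have h := conjGamma0_one (Subgroup.inclusion (Gamma0_le_of_dvd (one_dvd M)) γ)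
  change detThetaMultiplier (conjGamma0 1 _) = _
  rw [h]
  rfl

lemma conjChar_omega_mul {M : ℕ} :
    conjChar (restrictChar (one_dvd M) (omega 1)) * restrictChar (one_dvd M) (omega 1) = 1 := by
  ext γ
  have h : conjChar (restrictChar (one_dvd M) (omega 1)) γ =
    (starRingEnd ℂ) (restrictChar (one_dvd M) (omega 1) γ) := rfl
  rw [MonoidHom.mul_apply, h, restrictChar_omega_one, conj_detThetaMultiplier_mul,
    MonoidHom.one_apply]

/-- The factor M makes g T^{12M} g⁻¹ congruent to the identity mod M, which kills χ. The factor 12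
kills ω, whose value on a conjugate is its value on T^{12M}. -/
lemma trivialOnTranslations {M : ℕ} (χ : DirichletCharacter ℂ M) :
    TrivialOnTranslations (dirichletChar χ * conjChar (restrictChar (one_dvd M) (omega 1)))
      (12 * M) := by
  intro g
  have hT : (ModularGroup.T ^ (12 * M)).1 = !![1, ((12 * M : ℕ) : ℤ); 0, 1] := by
    have := ModularGroup.coe_T_zpow (12 * M : ℕ)
    rwa [zpow_natCast] at this
  have hinv : (g⁻¹).1 = !![g 1 1, -g 0 1; -g 1 0, g 0 0] := by
    rw [Matrix.SpecialLinearGroup.coe_inv, Matrix.adjugate_fin_two]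
  have hdet := Matrix.det_fin_two g.1
  rw [g.2] at hdet
  have h10 : (g * ModularGroup.T ^ (12 * M) * g⁻¹) 1 0 = M * (-12 * g 1 0 ^ 2) := by
    simp only [Matrix.SpecialLinearGroup.coe_mul, Matrix.mul_apply, Fin.sum_univ_two, hT, hinv]
    simp
    ring
  have h11 : (g * ModularGroup.T ^ (12 * M) * g⁻¹) 1 1 = 1 + M * (12 * g 0 0 * g 1 0) := by
    simp only [Matrix.SpecialLinearGroup.coe_mul, Matrix.mul_apply, Fin.sum_univ_two, hT, hinv]
    simp
    linear_combination -hdet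
  have hmem : g * ModularGroup.T ^ (12 * M) * g⁻¹ ∈ Gamma0 M := by
    rw [Gamma0_mem, h10]
    simp
  refine ⟨⟨_, hmem⟩, rfl, ?_⟩
  have h1 : dirichletChar χ ⟨_, hmem⟩ = 1 := by
    change χ (((g * ModularGroup.T ^ (12 * M) * g⁻¹) 1 1 : ℤ) : ZMod M) = 1
    rw [h11]
    simp
  have h2 : conjChar (restrictChar (one_dvd M) (omega 1)) ⟨_, hmem⟩ =
    (starRingEnd ℂ) (restrictChar (one_dvd M) (omega 1) ⟨_, hmem⟩) := rfl
  have h3 : detThetaMultiplier (g * ModularGroup.T ^ (12 * M) * g⁻¹) = 1 := by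
    rw [map_mul, map_mul, mul_right_comm, ← map_mul, mul_inv_cancel, map_one, one_mul, pow_mul, map_pow,
      map_pow, detThetaMultiplier_pow, one_pow]
  rw [MonoidHom.mul_apply, h1, h2, restrictChar_omega_one, h3]
  simp

end

end JacobiRestriction

/-! ### The corollary -/

theorem corollary4p5 (k : ℤ) (hk : 0 < k) (m N : ℕ) (hm : Squarefree m) (hN : 0 < N)
    (χ : DirichletCharacter ℂ (m * N)) :
    Nonempty (jacobiKernel k 1 (m * N) (dirichletChar χ) ≃ₗ[ℂ]
      jacobiStarKernel k m (m * N)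
        (dirichletChar χ * restrictChar (Dvd.intro N rfl) (omega m) *
          conjChar (restrictChar (one_dvd (m * N)) (omega 1)))) ∧
    Nonempty (jacobiKernel k 1 (m * N) (dirichletChar χ) ≃ₗ[ℂ]
      modularForms (k - 1) (m * N)
        (dirichletChar χ * conjChar (restrictChar (one_dvd (m * N)) (omega 1)))) ∧
    Nonempty (jacobiStarKernel k m (m * N)
        (dirichletChar χ * restrictChar (Dvd.intro N rfl) (omega m) *
          conjChar (restrictChar (one_dvd (m * N)) (omega 1))) ≃ₗ[ℂ]
      modularForms (k - 1) (m * N)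
        (dirichletChar χ * conjChar (restrictChar (one_dvd (m * N)) (omega 1)))) := by
  have hm0 : 0 < m := Nat.pos_of_ne_zero hm.ne_zero
  have hH : 0 < 12 * (m * N) := by positivity
  have hν := trivialOnTranslations χ
  -- The same character χ ω̄ is used in index one and in index m; in index one the twist by ω
  -- cancels ω̄.
  have e1 : modularForms (k - 1) (m * N)
        (dirichletChar χ * conjChar (restrictChar (one_dvd (m * N)) (omega 1))) ≃ₗ[ℂ]
      jacobiKernel k 1 (m * N) (dirichletChar χ) :=
    (mulThetaDetEquiv one_pos (one_dvd _) hH hν).trans (LinearEquiv.ofEq _ _ (by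
      rw [mul_assoc, conjChar_omega_mul, mul_one, jacobiStarKernel, jacobiStar_one, jacobiKernel]))
  have e2 : modularForms (k - 1) (m * N)
        (dirichletChar χ * conjChar (restrictChar (one_dvd (m * N)) (omega 1))) ≃ₗ[ℂ]
      jacobiStarKernel k m (m * N)
        (dirichletChar χ * restrictChar (Dvd.intro N rfl) (omega m) *
          conjChar (restrictChar (one_dvd (m * N)) (omega 1))) :=
    (mulThetaDetEquiv hm0 (Dvd.intro N rfl) hH hν).trans (LinearEquiv.ofEq _ _ (by
      rw [mul_right_comm]))
  exact ⟨⟨e1.symm.trans e2⟩, ⟨e1.symm⟩, ⟨e2.symm⟩⟩
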